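/- **Setting.** Let $\Lambda$ be the Grassmann algebra over $\mathbb C$ on countably many generators, let $V_{\mathbb C}$ be a finite-dimensional $\mathbb Z/2$-graded complex vector space with a nondegenerate even supersymmetric bilinear form $(-,-)$ (so that $\operatorname{sdim}V_{\mathbb C}=(m|2n)$ for some $m,n$), let $V=V_{\mathbb C}\otimes\Lambda$, with the form extended $\Lambda$-bilinearly, and $V^*=\mathrm{Hom}_\Lambda(V,\Lambda)$. Tensor products are over $\Lambda$, and $T^r$ denotes the $r$-th tensor power. $\mathrm{GL}(V)$ is the group of invertible even $\Lambda$-endomorphisms of $V$, and $\mathrm{OSp}(V)$ its subgroup preserving the form. For an even endomorphism $A$ let $A^\dagger$ be its adjoint, $(Av,w)=(v,A^\dagger w)$, and $\omega(A)=A^\dagger A$, which is regarded as an element of $V^*\otimes V^*$ through the isomorphism $\zeta^*:V^*\otimes V^*\to\mathrm{End}_\Lambda(V)$, $\zeta^*((v,-)\otimes(w,-))(x)=v\,(w,x)$. For $\pi\in\mathrm{Sym}_r$ let $\varpi_r(\pi)$ be its action on $T^r(V)$ and on $T^r(V^*)$ by signed permutation of the factors, in which $(k,k+1)$ acts by $v\otimes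 w\mapsto(-1)^{[v][w]}w\otimes v$ on the factors $k,k+1$. Let $\langle-,-\rangle$ be the pairing of $T^r(V^*)$ and $T^r(V)$ with $$\langle\phi_1\otimes\dots\otimes\phi_r,\,v_1\otimes\dots\otimes v_r\rangle=(-1)^{\sum_{a<b}[v_a][\phi_b]}\phi_1(v_1)\cdots\phi_r(v_r)$$ for homogeneous $\phi_a$, $v_a$, and let $\delta_\pi\in(T^r(V^*)\otimes T^r(V))^*$, $\delta_\pi(\underline\psi\otimes\underline w)=\langle\underline\psi,\varpi_r(\pi)\underline w\rangle$. For $\pi\in\mathrm{Sym}_{2d}$ let $\kappa_\pi(\underline v)=\langle\varpi_{2d}(\pi)\underline v\rangle_0$, where $\langle v_1\otimes\dots\otimes v_{2d}\rangle_0=(v_1,v_2)(v_3,v_4)\cdots(v_{2d-1},v_{2d})$. Let $B_{2d}^0$ be the free $\Lambda$-module on the Brauer diagrams from $2d$ to $0$, that is, on the partitions of $\{1,\dots,2d\}$ into pairs. Let $D_0$ be the diagram $\{1,2\},\{3,4\},\dots,\{2d-1,2d\}$. For $\pi\in\mathrm{Sym}_{2d}$ the diagram $D_0\pi$ pairs $i$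 and $j$ if and only if $D_0$ pairs $\pi(i)$ and $\pi(j)$. Every diagram is $D=D_0\pi_D$ with $\pi_D\in\mathrm{Sym}_{2d}$ unique up to left multiplication by the centraliser $C$ of $(12)(34)\cdots(2d-1,2d)$. Let $e(C)=|C|^{-1}\sum_{\sigma\in C}\sigma$, and define $\Lambda$-linear maps by $$\kappa:B_{2d}^0\to T^{2d}(V)^*,\ \kappa(D)=\kappa_{\pi_D};\qquad \chi:B_{2d}^0\to\Lambda\mathrm{Sym}_{2d},\ \chi(D)=e(C)\pi_D;\qquad \delta:\Lambda\mathrm{Sym}_{2d}\to(T^{2d}(V^*)\otimes T^{2d}(V))^*,\ \delta(\pi)=\delta_\pi .$$ Let $S^d(S^2(V^*))$ be the quotient of $T^{2d}(V^*)$ by the action $\varpi_{2d}$ of $C$. For $L\in T^{2d}(V)^*$ let $F_L$ be the $\Lambda$-linear map $S^d(S^2(V^*))\otimes T^{2d}(V)\to\Lambda$ with $$F_L\bigl(\omega(A)^{\otimes d}\otimes v_1\otimes\dots\otimes v_{2d}\bigr)=L(Av_1\otimes\dots\otimes Av_{2d})$$ for all even $A\in\mathrm{End}_\Lambda(V)$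 and all $v_i\in V$, if there is exactly one such map, and let $h(L)\in(T^{2d}(V^*)\otimes T^{2d}(V))^*$ be its pullback along the projection $T^{2d}(V^*)\to S^d(S^2(V^*))$. **Proposition.** For all $d\ge 0$: $\kappa(D)$ and $\chi(D)$ do not depend on the choice of $\pi_D$, and for every $b\in B_{2d}^0$ one has $\kappa(b)\in(T^{2d}(V)^*)^{\mathrm{OSp}(V)}$, there is exactly one $F_{\kappa(b)}$ (so that $h(\kappa(b))$ is defined), $\delta(\chi(b))\in\bigl((T^{2d}(V^*)\otimes T^{2d}(V))^*\bigr)^{\mathrm{GL}(V)}$, and $$h(\kappa(b))=\delta(\chi(b)).$$ That is, $h\circ\kappa=\delta\circ\chi$ on $B_{2d}^0$. -/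

import Mathlib

open scoped BigOperators

namespace OrthoSuper

noncomputable section

/-! ### The Grassmann algebra -/

/-- The Grassmann algebra on countably many generators: the direct limit of the exterior
algebras of `ℂ ^ N`. -/
abbrev Gr : Type := ExteriorAlgebra ℂ (ℕ →₀ ℂ)

/-- The homogeneous component of parity `a` of the Grassmann algebra. -/
def Gr.part (a : ZMod 2) : Submodule ℂ Gr := CliffordAlgebra.evenOdd 0 a

/-- The sign `(-1) ^ a`. -/
def sgn (a : ZMod 2) : ℂ := if a = 0 then 1 else -1

/-- Moving a Grassmann scalar past a homogeneous vector of parity `a`: a scalar `x` of parity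
`b` is sent to `(-1) ^ (a * b) x`. -/
def tw (a : ZMod 2) : Gr →ₐ[ℂ] Gr :=
  if a = 0 then AlgHom.id ℂ Gr else CliffordAlgebra.involute

/-! ### Free supermodules and their tensor products

A superspace with homogeneous basis `e j`, `j : J`, of parities `q j` has as its extension of
scalars to `Gr` the free module `J → Gr`; the function `x` stands for `∑ j, e j * x j`, with the
scalars written on the right. The scalars act on the left through the sign rule
`c * e j = e j * tw (q j) c`. Linear maps are the right linear ones, that is, the `Grᵐᵒᵖ`-linear
ones, so that they are written on the left of their argument without signs.

Tensor products are over `Gr`. The tensor product of the modules on `J` and `K` is the free module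
on `J × K`, with basis `e j ⊗ e k`, and the `r`-th tensor power is the free module on `Fin r → J`,
with basis `e (i 0) ⊗ ⋯ ⊗ e (i (r - 1))`. -/

/-- The extension of scalars to `Gr` of the superspace with basis indexed by `J`. -/
abbrev Mod (J : Type*) : Type _ := J → Gr

/-- The `r`-th tensor power. -/
abbrev Tens (r : ℕ) (J : Type*) : Type _ := Mod (Fin r → J)

/-- The dual module: right linear maps to `Gr`. -/
abbrev Dual (J : Type*) : Type _ := Mod J →ₗ[Grᵐᵒᵖ] Gr

/-- The basis vector `e j`. -/
def e {J : Type*} [DecidableEq J] (j : J) : Mod J := Pi.single j 1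

/-- `x ⊗ y`: in `e j * x j ⊗ e k * y k` the scalar `x j` moves past `e k`. -/
def tmul {J K : Type*} (q : K → ZMod 2) (x : Mod J) (y : Mod K) : Mod (J × K) :=
  fun jk => tw (q jk.2) (x jk.1) * y jk.2

/-- `x 0 ⊗ ⋯ ⊗ x (r - 1)`: the coefficient of the `k`-th factor moves past the basis
vectors of all later factors. -/
def tprod {J : Type*} (q : J → ZMod 2) {r : ℕ} (x : Fin r → Mod J) : Tens r J :=
  fun i => (List.ofFn fun k => tw (∑ l ∈ Finset.Ioi k, q (i l)) (x k (i k))).prod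

/-- The coordinates of `φ` with respect to the dual basis `ε j` (of parity `q j`, with
`ε j (e k) = δ_jk`), scalars on the right: `φ = ∑ j, ε j * dualCoord q φ j`, where
`(ε j * c) (e j) = ε j (c * e j) = tw (q j) c`. Thus `V^*` is again a module `Mod J`. -/
def dualCoord {J : Type*} [DecidableEq J] (q : J → ZMod 2) (φ : Dual J) : Mod J :=
  fun j => tw (q j) (φ (e j))

section Space

variable {I : Type*} [Fintype I] [DecidableEq I] (p : I → ZMod 2) (η : Matrix I I ℂ)

/-! ### The orthosymplectic form, endomorphisms and the groups -/

/-- `η` is the Gram matrix `(e a, e b) = η a b` of a nondegenerate even supersymmetric bilinear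
form on the complex superspace with homogeneous basis `e a` of parity `p a`. -/
structure IsOrthosymplectic : Prop where
  even : ∀ a b, p a ≠ p b → η a b = 0
  supersymm : ∀ a b, η a b = sgn (p a * p b) * η b a
  nondegenerate : IsUnit η.det

/-- The linear functional `φ_v = (v, -)`. Here `(e a * x, e b * y) = tw (p a) x * η a b * y`. -/
def lower (v : Mod I) : Dual I where
  toFun w := ∑ a, ∑ b, η a b • (tw (p a) (v a) * w b)
  map_add' x y := by simp [mul_add, Finset.sum_add_distrib]
  map_smul' c x := by simp [Finset.sum_mul, mul_assoc]

/-- The `Gr`-bilinear extension of the form. -/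
def form (v w : Mod I) : Gr := lower p η v w

/-- The ring of `Gr`-endomorphisms. -/
abbrev EndV (I : Type*) : Type _ := Module.End Grᵐᵒᵖ (Mod I)

/-- The endomorphism `A` is even: `A (e b)` has parity `p b`. -/
def IsEven (A : EndV I) : Prop := ∀ a b, A (e b) a ∈ Gr.part (p a + p b)

/-- The adjoint `A†` of an even endomorphism `A`, determined by `(A v, w) = (v, A† w)`. -/
def dagger (A : EndV I) : EndV I where
  toFun w := fun a => ∑ b, η⁻¹ a b • form p η (A (e b)) w
  map_add' x y := by ext a; simp [form, Finset.sum_add_distrib]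
  map_smul' c x := by ext a; simp [form, Finset.sum_mul]

/-- `ω(A) = A† A`. -/
def omega (A : EndV I) : EndV I := dagger p η A * A

/-- `GL(V)`: the invertible even endomorphisms. -/
def GLV : Set (EndV I)ˣ := {g | IsEven p (g : EndV I)}

/-- `OSp(V)`: the elements of `GL(V)` that preserve the form. -/
def OSpV : Set (EndV I)ˣ :=
  {g | g ∈ GLV p ∧ ∀ v w, form p η ((g : EndV I) v) ((g : EndV I) w) = form p η v w}

/-- The module `(T^r(V)^*)^{OSp(V)}`. -/
def invOSp (r : ℕ) : Submodule Gr (Dual (Fin r → I)) where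
  carrier := {L | ∀ g ∈ OSpV p η, ∀ v : Fin r → Mod I,
    L (tprod p fun k => (g : EndV I) (v k)) = L (tprod p v)}
  zero_mem' := by intro g _ v; rfl
  add_mem' := by intro L M hL hM g hg v; simp [hL g hg v, hM g hg v]
  smul_mem' := by intro c L hL g hg v; simp [hL g hg v]

/-- The free module `T^r(V^*) ⊗ T^r(V)`, with basis the `ε_i ⊗ e_j`. -/
abbrev TT (r : ℕ) (I : Type*) : Type _ := Mod ((Fin r → I) × (Fin r → I))

/-- The parity of a basis element of `T^r(V)`. -/
def parT {r : ℕ} (i : Fin r → I) : ZMod 2 := ∑ k, p (i k)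

/-- The module `((T^r(V^*) ⊗ T^r(V))^*)^{GL(V)}`; an element `g` acts on `V^*`
by `φ ↦ φ ∘ g⁻¹`. -/
def invGL (r : ℕ) : Submodule Gr (TT r I →ₗ[Grᵐᵒᵖ] Gr) where
  carrier := {H | ∀ g ∈ GLV p, ∀ (φ : Fin r → Dual I) (v : Fin r → Mod I),
    H (tmul (parT p)
        (tprod p fun k => dualCoord p ((φ k).comp ((g⁻¹ : (EndV I)ˣ) : EndV I)))
        (tprod p fun k => (g : EndV I) (v k)))
      = H (tmul (parT p) (tprod p fun k => dualCoord p (φ k)) (tprod p v))}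
  zero_mem' := by intro g _ φ v; rfl
  add_mem' := by intro L M hL hM g hg φ v; simp [hL g hg φ v, hM g hg φ v]
  smul_mem' := by intro c L hL g hg φ v; simp [hL g hg φ v]

/-! ### The action of the symmetric group and the functions `κ_π`, `δ_π` -/

/-- The exponent of the sign that arises when the factors of `e (i 0) ⊗ ⋯ ⊗ e (i (r - 1))` are
permuted, the factor in position `a` going to position `π a`: the sum of the products of
parities over the inversions of `π`. -/
def inversionParity {r : ℕ} (π : Equiv.Perm (Fin r)) (i : Fin r → I) : ZMod 2 :=
  ∑ a, ∑ b ∈ Finset.Ioi a, if π b < π a then p (i a) * p (i b) else 0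

/-- The action `ϖ_r` of the symmetric group on the `r`-th tensor power, generated by
`ϖ_r (k, k+1) = id ⊗ τ ⊗ id` with `τ (v ⊗ w) = (-1)^([v][w]) w ⊗ v`. On basis elements,
`ϖ_r π (e_i) = ± e_{i ∘ π⁻¹}`. -/
def varpi {r : ℕ} (π : Equiv.Perm (Fin r)) : Tens r I →ₗ[Grᵐᵒᵖ] Tens r I where
  toFun x := fun j => sgn (inversionParity p π (j ∘ π)) • x (j ∘ π)
  map_add' x y := by ext j; simp
  map_smul' c x := by ext j; simp

/-- `ϖ_r π ⊗ id` on `T^r(V^*) ⊗ T^r(V)`. -/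
def varpiLeft {r : ℕ} (π : Equiv.Perm (Fin r)) : TT r I →ₗ[Grᵐᵒᵖ] TT r I where
  toFun z := fun ij => varpi p π (fun i => z (i, ij.2)) ij.1
  map_add' x y := by ext ij; simp [varpi]
  map_smul' c x := by ext ij; simp [varpi]

/-- `id ⊗ ϖ_r π` on `T^r(V^*) ⊗ T^r(V)`. -/
def varpiRight {r : ℕ} (π : Equiv.Perm (Fin r)) : TT r I →ₗ[Grᵐᵒᵖ] TT r I where
  toFun z := fun ij => varpi p π (fun j => z (ij.1, j)) ij.2
  map_add' x y := by ext ij; simp [varpi]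
  map_smul' c x := by ext ij; simp [varpi]

/-- The pairing `⟨-, -⟩` of `T^r(V^*)` with `T^r(V)`, as a linear map on their tensor product:
`⟨φ_1 ⊗ ⋯ ⊗ φ_r, v_1 ⊗ ⋯ ⊗ v_r⟩` is `φ_1 v_1 ⋯ φ_r v_r` with the sign of exponent
`∑_{a < b} [v_a] [φ_b]`. -/
def pairing (r : ℕ) : TT r I →ₗ[Grᵐᵒᵖ] Gr where
  toFun z := ∑ i : Fin r → I, sgn (∑ a, ∑ b ∈ Finset.Ioi a, p (i a) * p (i b)) • z (i, i)
  map_add' x y := by simp [Finset.sum_add_distrib]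
  map_smul' c x := by simp [Finset.sum_mul]

/-- `δ_π (ψ ⊗ w) = ⟨ψ, ϖ_r π w⟩`. -/
def deltaPerm {r : ℕ} (π : Equiv.Perm (Fin r)) : TT r I →ₗ[Grᵐᵒᵖ] Gr :=
  (pairing p r).comp (varpiRight p π)

/-- The linear map `δ` on the group ring, with `δ π = δ_π`. -/
def delta {r : ℕ} :
    MonoidAlgebra Gr (Equiv.Perm (Fin r)) →ₗ[Gr] (TT r I →ₗ[Grᵐᵒᵖ] Gr) where
  toFun x := ∑ π, x.coeff π • deltaPerm p π
  map_add' x y := by simp [add_smul, Finset.sum_add_distrib]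
  map_smul' c x := by simp [mul_smul, Finset.smul_sum]

variable {p η}

/-- The position `2k - 1` (counted from `1`) for the `k`-th pair. -/
def pos1 {d : ℕ} (k : Fin d) : Fin (2 * d) := ⟨2 * k, by omega⟩

/-- The position `2k` (counted from `1`) for the `k`-th pair. -/
def pos2 {d : ℕ} (k : Fin d) : Fin (2 * d) := ⟨2 * k + 1, by omega⟩

variable (p η)

/-- `⟨v_1 ⊗ ⋯ ⊗ v_{2d}⟩_0 = (v_1, v_2) (v_3, v_4) ⋯ (v_{2d-1}, v_{2d})`. -/
def bracket (d : ℕ) : Dual (Fin (2 * d) → I) where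
  toFun x := ∑ i : Fin (2 * d) → I, (∏ k : Fin d, η (i (pos1 k)) (i (pos2 k))) • x i
  map_add' x y := by simp [Finset.sum_add_distrib]
  map_smul' c x := by simp [Finset.sum_mul]

/-- `κ_π (v) = ⟨ϖ_{2d} π v⟩_0`. -/
def kappaPerm {d : ℕ} (π : Equiv.Perm (Fin (2 * d))) : Dual (Fin (2 * d) → I) :=
  (bracket η d).comp (varpi p π)

end Space

/-! ### Brauer diagrams from `2d` to `0` -/

/-- The involution `(12)(34)⋯(2d-1,2d)`. -/
def pairInvolution (d : ℕ) : Equiv.Perm (Fin (2 * d)) :=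
  Function.Involutive.toPerm
    (fun k => if h : k.1 % 2 = 0 then ⟨k.1 + 1, by omega⟩ else ⟨k.1 - 1, by omega⟩)
    (by
      intro k
      by_cases hk : k.1 % 2 = 0
      · have h1 : (k.1 + 1) % 2 ≠ 0 := by omega
        simp [hk, h1]
      · have h1 : (k.1 - 1) % 2 = 0 := by omega
        simp only [hk, h1, dite_true, dite_false]
        apply Fin.ext
        dsimp only
        omega)

/-- A Brauer diagram from `2d` to `0`: a partition of the `2d` points into pairs, recorded by the
map that sends each point to its partner. -/
structure Diagram (d : ℕ) where
  partner : Equiv.Perm (Fin (2 * d))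
  partner_partner : ∀ i, partner (partner i) = i
  partner_ne : ∀ i, partner i ≠ i

/-- The diagram `D_0` of the pairs `{1, 2}, {3, 4}, …`. -/
def D0 (d : ℕ) : Diagram d where
  partner := pairInvolution d
  partner_partner i := by
    apply Function.Involutive.toPerm_involutive
  partner_ne i := by
    intro h
    have h1 := congrArg Fin.val h
    change Fin.val (dite _ _ _) = _ at h1
    split_ifs at h1 <;> dsimp only at * <;> omega

/-- The composition `D π`, where `π` joins the bottom point `i` to the top point `π i`:
two points `i`, `j` are paired in `D π` when `π i`, `π j` are paired in `D`. -/
def Diagram.comp {d : ℕ} (D : Diagram d) (π : Equiv.Perm (Fin (2 * d))) : Diagram d where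
  partner := π⁻¹ * D.partner * π
  partner_partner i := by simp [D.partner_partner]
  partner_ne i := by
    rw [Equiv.Perm.mul_apply, Equiv.Perm.mul_apply, Ne, Equiv.Perm.inv_eq_iff_eq]
    exact D.partner_ne (π i)

theorem Diagram.cycleType_partner {d : ℕ} (D : Diagram d) :
    D.partner.cycleType = Multiset.replicate d 2 := by
  have h1 : ∀ c ∈ D.partner.cycleType, c = 2 := by
    apply (Equiv.Perm.pow_prime_eq_one_iff (p := 2)).1
    ext i
    simp [pow_two, D.partner_partner]
  have h2 := Multiset.eq_replicate_of_mem h1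
  have h3 : D.partner.support = Finset.univ := by
    ext i
    simp [D.partner_ne]
  have h4 := Equiv.Perm.sum_cycleType D.partner
  rw [h2, h3] at h4
  simp at h4
  rw [h2]
  congr 1
  omega

theorem Diagram.exists_perm {d : ℕ} (D : Diagram d) : ∃ π, (D0 d).comp π = D := by
  have h : IsConj D.partner (D0 d).partner := by
    rw [Equiv.Perm.isConj_iff_cycleType_eq, D.cycleType_partner, (D0 d).cycleType_partner]
  obtain ⟨π, hπ⟩ := isConj_iff.1 h
  refine ⟨π, ?_⟩
  cases D
  simp only [Diagram.comp, Diagram.mk.injEq]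
  rw [← hπ]
  simp [mul_assoc]

/-- A permutation `π_D` with `D = D_0 π_D`, unique up to left multiplication by the centraliser
of `(12)(34)⋯(2d-1,2d)`. -/
def Diagram.perm {d : ℕ} (D : Diagram d) : Equiv.Perm (Fin (2 * d)) := D.exists_perm.choose

/-- The free module `B_{2d}^0` on the Brauer diagrams from `2d` to `0`. -/
abbrev Brauer (d : ℕ) : Type := Diagram d →₀ Gr

/-- The centraliser `C` of `(12)(34)⋯(2d-1,2d)`. -/
def centr (d : ℕ) : Subgroup (Equiv.Perm (Fin (2 * d))) :=
  Subgroup.centralizer {pairInvolution d}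

open Classical in
/-- The symmetriser `e(C) = |C|⁻¹ ∑_{σ ∈ C} σ`. -/
def symmetriser (d : ℕ) : MonoidAlgebra Gr (Equiv.Perm (Fin (2 * d))) :=
  (Nat.card (centr d) : ℂ)⁻¹ • ∑ σ : centr d, MonoidAlgebra.single (σ : Equiv.Perm _) 1

/-- The linear map `χ`, with `χ D = e(C) π_D`. -/
def chi (d : ℕ) : Brauer d →ₗ[Gr] MonoidAlgebra Gr (Equiv.Perm (Fin (2 * d))) :=
  Finsupp.linearCombination Gr fun D => symmetriser d * MonoidAlgebra.single D.perm 1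

section Extension

variable {I : Type*} [Fintype I] [DecidableEq I] (p : I → ZMod 2) (η : Matrix I I ℂ)

/-- The linear map `κ`, with `κ D = κ_D = κ_{π_D}`. -/
def kappa (d : ℕ) : Brauer d →ₗ[Gr] Dual (Fin (2 * d) → I) :=
  Finsupp.linearCombination Gr fun D => kappaPerm p η D.perm

/-! ### The map `h` -/

/-- The inverse of the canonical isomorphism `ζ^* : V^* ⊗ V^* → End(V)`,
`ζ^* (φ_v ⊗ φ_w) (x) = v (w, x)`, so that `ζ^* (φ_v ⊗ ψ) (x) = v ψ(x)`: the endomorphism `B` is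
the image of `∑ a, φ_{B e_a} ⊗ ε_a`. -/
def zetaInv (B : EndV I) : Mod (I × I) :=
  ∑ a, tmul p (dualCoord p (lower p η (B (e a)))) (e a)

/-- The `d`-th tensor power `t ⊗ ⋯ ⊗ t` of `t ∈ V^* ⊗ V^*`, as an element of `T^{2d}(V^*)`. -/
def tensPow (d : ℕ) (t : Mod (I × I)) : Tens (2 * d) I :=
  fun i => tprod (fun ab : I × I => p ab.1 + p ab.2) (fun _ : Fin d => t)
    fun k => (i (pos1 k), i (pos2 k))

/-- The kernel of the projection of `T^{2d}(V^*) ⊗ T^{2d}(V)` onto `S^d(S^2(V^*)) ⊗ T^{2d}(V)`. -/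
def symKer (d : ℕ) : Submodule Grᵐᵒᵖ (TT (2 * d) I) :=
  Submodule.span Grᵐᵒᵖ {y | ∃ σ ∈ centr d, ∃ z : TT (2 * d) I, y = varpiLeft p σ z - z}

/-- `S^d(S^2(V^*)) ⊗ T^{2d}(V)`, where `S^d(S^2(V^*))` is the quotient of `T^{2d}(V^*)` by the
action of the centraliser `C`. -/
abbrev SymTens (d : ℕ) : Type _ := TT (2 * d) I ⧸ symKer (I := I) p d

/-- `F` is the extension `F_L` of `L`: it is the linear map on `S^d(S^2(V^*)) ⊗ T^{2d}(V)`
(equivalently, the polynomial function of degree `d` on `S^2(V^*)_0` with values in `T^{2d}(V)^*`)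
with `F (ω(A) ⊗ v_1 ⊗ ⋯ ⊗ v_{2d}) = L (A v_1 ⊗ ⋯ ⊗ A v_{2d})` for all even endomorphisms `A`,
where `ω(A)` stands for the class of its `d`-th tensor power. -/
def IsExtension {d : ℕ} (L : Dual (Fin (2 * d) → I)) (F : SymTens p d →ₗ[Grᵐᵒᵖ] Gr) : Prop :=
  ∀ A : EndV I, IsEven p A → ∀ v : Fin (2 * d) → Mod I,
    F ((symKer p d).mkQ
        (tmul (parT p) (tensPow p d (zetaInv p η (omega p η A))) (tprod p v)))
      = L (tprod p fun k => A (v k))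

open Classical in
/-- `h L = H_L`, the pullback of `F_L` to `T^{2d}(V^*) ⊗ T^{2d}(V)` (and `0` in case there is no
`F_L`). -/
def h {d : ℕ} (L : Dual (Fin (2 * d) → I)) : TT (2 * d) I →ₗ[Grᵐᵒᵖ] Gr :=
  if hL : ∃ F, IsExtension p η L F then hL.choose.comp (symKer p d).mkQ else 0

end Extension

end

end OrthoSuper

namespace OrthoSuper

noncomputable section

set_option linter.unusedSectionVars false

/-! ### Signs and parities -/

theorem sgn_zero : sgn 0 = 1 := by simp [sgn]

theorem sgn_one : sgn 1 = -1 := by simp [sgn]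

theorem ZMod2.eq_zero_or_one (a : ZMod 2) : a = 0 ∨ a = 1 := by
  revert a; decide

theorem ZMod2.one_add_one : (1 + 1 : ZMod 2) = 0 := rfl

theorem sgn_add (a b : ZMod 2) : sgn (a + b) = sgn a * sgn b := by
  rcases ZMod2.eq_zero_or_one a with rfl | rfl <;> rcases ZMod2.eq_zero_or_one b with rfl | rfl <;>
    simp [sgn_zero, sgn_one, ZMod2.one_add_one]

theorem sgn_mul_self (a : ZMod 2) : sgn a * sgn a = 1 := by
  rcases ZMod2.eq_zero_or_one a with rfl | rfl <;> simp [sgn_zero, sgn_one]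

theorem sgn_sum {ι : Type*} (s : Finset ι) (f : ι → ZMod 2) :
    sgn (∑ i ∈ s, f i) = ∏ i ∈ s, sgn (f i) := by
  classical
  induction s using Finset.induction_on with
  | empty => simp [sgn]
  | insert a s ha ih => rw [Finset.sum_insert ha, Finset.prod_insert ha, sgn_add, ih]

theorem ZMod2.mul_self (a : ZMod 2) : a * a = a := by
  fin_cases a <;> rfl

theorem ZMod2.add_self (a : ZMod 2) : a + a = 0 := CharTwo.add_self_eq_zero a

/-! ### Twists and supercommutativity -/

@[simp] theorem tw_zero (x : Gr) : tw 0 x = x := by simp [tw]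

theorem tw_one (x : Gr) : tw 1 x = CliffordAlgebra.involute x := by simp [tw]

theorem tw_tw (a b : ZMod 2) (x : Gr) : tw a (tw b x) = tw (a + b) x := by
  rcases ZMod2.eq_zero_or_one a with rfl | rfl <;> rcases ZMod2.eq_zero_or_one b with rfl | rfl
  · simp
  · simp
  · simp
  · rw [ZMod2.one_add_one, tw_zero, tw_one, tw_one, CliffordAlgebra.involute_involute]

theorem one_mem_part : (1 : Gr) ∈ Gr.part 0 :=
  CliffordAlgebra.one_le_evenOdd_zero _ (Submodule.mem_one.2 ⟨1, map_one _⟩)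

theorem mul_mem_part {a b : ZMod 2} {x y : Gr} (hx : x ∈ Gr.part a) (hy : y ∈ Gr.part b) :
    x * y ∈ Gr.part (a + b) :=
  CliffordAlgebra.evenOdd_mul_le _ a b (Submodule.mul_mem_mul hx hy)

theorem tw_of_mem (a : ZMod 2) {b : ZMod 2} {x : Gr} (hx : x ∈ Gr.part b) :
    tw a x = sgn (a * b) • x := by
  rcases ZMod2.eq_zero_or_one a with rfl | rfl
  · simp [sgn_zero]
  · rw [tw_one]
    rcases ZMod2.eq_zero_or_one b with rfl | rfl
    · simpa [sgn_zero] using CliffordAlgebra.involute_eq_of_mem_even hx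
    · simpa [sgn_one] using CliffordAlgebra.involute_eq_of_mem_odd hx

theorem tw_mem {a b : ZMod 2} {x : Gr} (hx : x ∈ Gr.part b) : tw a x ∈ Gr.part b := by
  rw [tw_of_mem a hx]
  exact Submodule.smul_mem _ _ hx

theorem ι_mul_eq (v : ℕ →₀ ℂ) (x : Gr) :
    ExteriorAlgebra.ι ℂ v * x = CliffordAlgebra.involute x * ExteriorAlgebra.ι ℂ v := by
  induction x using CliffordAlgebra.left_induction with
  | algebraMap r => simpa using (Algebra.commutes r _).symm
  | add x y hx hy => simp [mul_add, add_mul, hx, hy]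
  | ι_mul x w hx =>
    have h1 := ExteriorAlgebra.ι_add_mul_swap (R := ℂ) v w
    have h2 : ExteriorAlgebra.ι ℂ v * ExteriorAlgebra.ι ℂ w
        = - (ExteriorAlgebra.ι ℂ w * ExteriorAlgebra.ι ℂ v) := eq_neg_of_add_eq_zero_left h1
    change ExteriorAlgebra.ι ℂ v * (ExteriorAlgebra.ι ℂ w * x) = _
    rw [← mul_assoc, h2, neg_mul, mul_assoc, hx, map_mul, CliffordAlgebra.involute_ι]
    simp [mul_assoc]

/-- Supercommutativity with only one factor homogeneous: the sign becomes the automorphism `tw a` of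
the other factor. This is why coefficients can be moved below without being split by parity. -/
theorem mul_of_mem {a : ZMod 2} {x : Gr} (hx : x ∈ Gr.part a) (y : Gr) :
    y * x = x * tw a y := by
  induction y using CliffordAlgebra.left_induction with
  | algebraMap r => simpa using Algebra.commutes r x
  | add y z hy hz => simp [mul_add, add_mul, hy, hz]
  | ι_mul y w hy =>
    rw [mul_assoc, hy, map_mul, ← mul_assoc, ← mul_assoc]
    congr 1
    change ExteriorAlgebra.ι ℂ w * x = _
    rw [ι_mul_eq]
    have h1 := tw_of_mem 1 hx
    have h2 : CliffordAlgebra.involute x = tw 1 x := by simp [tw]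
    rw [h2, h1, tw_of_mem a (CliffordAlgebra.ι_mem_evenOdd_one _ w)]
    simp [ExteriorAlgebra.ι]

theorem comm_of_mem {a b : ZMod 2} {x y : Gr} (hx : x ∈ Gr.part a) (hy : y ∈ Gr.part b) :
    y * x = sgn (a * b) • (x * y) := by
  rw [mul_of_mem hx, tw_of_mem a hy, mul_smul_comm]

theorem commute_of_even {x : Gr} (hx : x ∈ Gr.part 0) (y : Gr) : y * x = x * y := by
  rw [mul_of_mem hx, tw_zero]

/-! ### Ordered products in the Grassmann algebra -/

/-- The ordered product. -/
def oprod {r : ℕ} (x : Fin r → Gr) : Gr := (List.ofFn x).prod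

theorem oprod_zero (x : Fin 0 → Gr) : oprod x = 1 := by simp [oprod]

theorem oprod_succ {r : ℕ} (x : Fin (r + 1) → Gr) :
    oprod x = x 0 * oprod fun k => x k.succ := by simp [oprod]

theorem map_oprod (f : Gr →ₐ[ℂ] Gr) {r : ℕ} (x : Fin r → Gr) :
    f (oprod x) = oprod fun k => f (x k) := by
  simp [oprod, map_list_prod, List.map_ofFn, Function.comp_def]

theorem oprod_smul {r : ℕ} (c : Fin r → ℂ) (x : Fin r → Gr) :
    oprod (fun k => c k • x k) = (∏ k, c k) • oprod x :=
  (MultilinearMap.mkPiAlgebraFin ℂ r Gr).map_smul_univ c x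

theorem oprod_sum {r : ℕ} {J : Type*} [Fintype J] (x : Fin r → J → Gr) :
    oprod (fun k => ∑ j, x k j) = ∑ i : Fin r → J, oprod fun k => x k (i k) := by
  classical
  exact (MultilinearMap.mkPiAlgebraFin ℂ r Gr).map_sum x

theorem oprod_eq_zero {r : ℕ} {x : Fin r → Gr} (k : Fin r) (h : x k = 0) : oprod x = 0 :=
  (MultilinearMap.mkPiAlgebraFin ℂ r Gr).map_coord_zero k h

theorem oprod_one {r : ℕ} : oprod (fun _ : Fin r => (1 : Gr)) = 1 := by
  simp [oprod]

theorem oprod_mem {r : ℕ} {α : Fin r → ZMod 2} {x : Fin r → Gr} (hx : ∀ k, x k ∈ Gr.part (α k)) :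
    oprod x ∈ Gr.part (∑ k, α k) := by
  induction r with
  | zero => simpa [oprod_zero] using one_mem_part
  | succ r ih =>
    rw [oprod_succ, Fin.sum_univ_succ]
    exact mul_mem_part (hx 0) (ih fun k => hx k.succ)

theorem sum_Ioi_eq {r : ℕ} {M : Type*} [AddCommMonoid M] (f : Fin r → M) (k : Fin r) :
    ∑ l ∈ Finset.Ioi k, f l = ∑ l, if k < l then f l else 0 := by
  rw [← Finset.sum_filter]; congr 1; ext l; simp

theorem sum_Iio_eq {r : ℕ} {M : Type*} [AddCommMonoid M] (f : Fin r → M) (k : Fin r) :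
    ∑ l ∈ Finset.Iio k, f l = ∑ l, if l < k then f l else 0 := by
  rw [← Finset.sum_filter]; congr 1; ext l; simp

theorem sum_Iio_add_Ioi {r : ℕ} {M : Type*} [AddCommMonoid M] (f : Fin r → M) (k : Fin r) :
    ∑ l ∈ Finset.Iio k, f l + f k + ∑ l ∈ Finset.Ioi k, f l = ∑ l, f l := by
  have h : f k = ∑ l, if l = k then f l else 0 := by simp
  rw [sum_Iio_eq, sum_Ioi_eq, h, ← Finset.sum_add_distrib, ← Finset.sum_add_distrib]
  refine Finset.sum_congr rfl fun l _ => ?_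
  rcases lt_trichotomy l k with hl | rfl | hl
  · simp [hl, hl.ne, hl.not_gt]
  · simp
  · simp [hl, hl.ne', hl.not_gt]

theorem sum_Ioi_zero {r : ℕ} {M : Type*} [AddCommMonoid M] (f : Fin (r + 1) → M) :
    ∑ l ∈ Finset.Ioi 0, f l = ∑ l : Fin r, f l.succ := by
  rw [sum_Ioi_eq, Fin.sum_univ_succ]; simp

theorem sum_Ioi_succ {r : ℕ} {M : Type*} [AddCommMonoid M] (f : Fin (r + 1) → M) (k : Fin r) :
    ∑ l ∈ Finset.Ioi k.succ, f l = ∑ l ∈ Finset.Ioi k, f l.succ := by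
  rw [← Fin.map_succEmb_Ioi]; simp

/-- Each `x k` moves right past the later factors `a l`, `k < l`, and is twisted by their parities.
-/
theorem oprod_mul {r : ℕ} {α : Fin r → ZMod 2} {a : Fin r → Gr} (ha : ∀ k, a k ∈ Gr.part (α k))
    (x : Fin r → Gr) :
    oprod (fun k => a k * x k)
      = oprod a * oprod fun k => tw (∑ l ∈ Finset.Ioi k, α l) (x k) := by
  induction r with
  | zero => simp [oprod_zero]
  | succ r ih =>
    rw [oprod_succ, oprod_succ a, oprod_succ (fun k => tw _ _), ih (fun k => ha k.succ),
      sum_Ioi_zero]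
    simp only [sum_Ioi_succ]
    have h := mul_of_mem (oprod_mem fun k => ha (Fin.succ k)) (x 0)
    rw [mul_assoc, mul_assoc, ← mul_assoc (x 0), h]
    simp only [mul_assoc]

/-- Here each `x k` moves left past the earlier `a l`. Obtained from `oprod_mul` by moving every
factor to the other side; the superfluous twists cancel mod 2. -/
theorem oprod_mul' {r : ℕ} {α : Fin r → ZMod 2} {a : Fin r → Gr} (ha : ∀ k, a k ∈ Gr.part (α k))
    (x : Fin r → Gr) :
    oprod (fun k => x k * a k)
      = (oprod fun k => tw (∑ l ∈ Finset.Iio k, α l) (x k)) * oprod a := by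
  rw [mul_of_mem (oprod_mem ha), map_oprod]
  simp only [mul_of_mem (ha _), oprod_mul ha, tw_tw]
  congr 2
  ext1 k
  congr 2
  rw [← sum_Iio_add_Ioi α k]
  linear_combination - ZMod2.add_self (∑ l ∈ Finset.Iio k, α l)

/-! ### Inversion signs and reordering of products -/

/-- The exponent of the sign that arises when factors of parities `α` are permuted by `π`. -/
def inv {r : ℕ} (π : Equiv.Perm (Fin r)) (α : Fin r → ZMod 2) : ZMod 2 :=
  ∑ a, ∑ b ∈ Finset.Ioi a, if π b < π a then α a * α b else 0

theorem inv_one {r : ℕ} (α : Fin r → ZMod 2) : inv 1 α = 0 := by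
  refine Finset.sum_eq_zero fun a _ => Finset.sum_eq_zero fun b hb => ?_
  rw [Finset.mem_Ioi] at hb
  simp [hb.not_gt]

/-- A symmetric `g` is a function of unordered pairs, and σ permutes these. -/
theorem sum_pairs_comp {r : ℕ} {M : Type*} [AddCommMonoid M] (σ : Equiv.Perm (Fin r))
    (g : Fin r → Fin r → M) (hg : ∀ a b, g a b = g b a) :
    ∑ a, ∑ b ∈ Finset.Ioi a, g (σ a) (σ b) = ∑ a, ∑ b ∈ Finset.Ioi a, g a b := by
  rw [Finset.sum_sigma', Finset.sum_sigma']
  refine Finset.sum_bij'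
    (fun x _ => if σ x.1 < σ x.2 then ⟨σ x.1, σ x.2⟩ else ⟨σ x.2, σ x.1⟩)
    (fun x _ => if σ.symm x.1 < σ.symm x.2 then ⟨σ.symm x.1, σ.symm x.2⟩
      else ⟨σ.symm x.2, σ.symm x.1⟩) ?_ ?_ ?_ ?_ ?_
  · rintro ⟨a, b⟩ h
    simp only [Finset.mem_sigma, Finset.mem_univ, Finset.mem_Ioi, true_and] at h ⊢
    split_ifs with h1
    · exact h1
    · exact lt_of_le_of_ne (not_lt.1 h1) fun h2 => h.ne' (σ.injective h2)
  · rintro ⟨a, b⟩ h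
    simp only [Finset.mem_sigma, Finset.mem_univ, Finset.mem_Ioi, true_and] at h ⊢
    split_ifs with h1
    · exact h1
    · exact lt_of_le_of_ne (not_lt.1 h1) fun h2 => h.ne' (σ.symm.injective h2)
  · rintro ⟨a, b⟩ h
    simp only [Finset.mem_sigma, Finset.mem_univ, Finset.mem_Ioi, true_and] at h
    dsimp only
    split_ifs with h1 h2 h3 <;> simp_all [h.not_gt]
  · rintro ⟨a, b⟩ h
    simp only [Finset.mem_sigma, Finset.mem_univ, Finset.mem_Ioi, true_and] at h
    dsimp only
    split_ifs with h1 h2 h3 <;> simp_all [h.not_gt]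
  · rintro ⟨a, b⟩ h
    dsimp only
    split_ifs with h1
    · rfl
    · exact hg _ _

/-- Cocycle rule: `π * σ` inverts a pair exactly when one, but not both, of σ (on the pair) and π
(on its image) does; double inversions contribute twice, hence 0 mod 2. -/
theorem inv_mul {r : ℕ} (π σ : Equiv.Perm (Fin r)) (α : Fin r → ZMod 2) :
    inv (π * σ) α = inv σ α + inv π (α ∘ σ.symm) := by
  have h := sum_pairs_comp σ (fun a b => if (a < b ∧ π b < π a) ∨ (b < a ∧ π a < π b) then
    α (σ.symm a) * α (σ.symm b) else 0) (fun a b => by simp [or_comm, mul_comm])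
  have h1 : inv π (α ∘ σ.symm) = ∑ a, ∑ b ∈ Finset.Ioi a,
      if (a < b ∧ π b < π a) ∨ (b < a ∧ π a < π b) then
        α (σ.symm a) * α (σ.symm b) else 0 := by
    refine Finset.sum_congr rfl fun a _ => Finset.sum_congr rfl fun b hb => ?_
    rw [Finset.mem_Ioi] at hb
    simp [hb, hb.not_gt]
  rw [h1, ← h, inv, inv, ← Finset.sum_add_distrib]
  refine Finset.sum_congr rfl fun a _ => ?_
  rw [← Finset.sum_add_distrib]
  refine Finset.sum_congr rfl fun b hb => ?_
  rw [Finset.mem_Ioi] at hb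
  have h2 : σ a ≠ σ b := fun h => hb.ne (σ.injective h)
  have h3 : π (σ a) ≠ π (σ b) := fun h => h2 (π.injective h)
  have h4 := ZMod2.add_self (α a * α b)
  simp only [Equiv.Perm.mul_apply, Equiv.symm_apply_apply]
  rcases lt_or_gt_of_ne h2 with h5 | h5 <;> rcases lt_or_gt_of_ne h3 with h6 | h6 <;>
    simp [h5, h6, h5.not_gt, h6.not_gt, h4]

theorem inv_symm {r : ℕ} (π : Equiv.Perm (Fin r)) (α : Fin r → ZMod 2) :
    inv π.symm (α ∘ π.symm) = inv π α := by
  have h := inv_mul π.symm π α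
  have h1 : π.symm * π = 1 := by ext; simp
  rw [h1, inv_one] at h
  exact (CharTwo.add_eq_zero.1 h.symm).symm

theorem oprod_swap {r : ℕ} (k : Fin r) {α : Fin (r + 1) → ZMod 2} {a : Fin (r + 1) → Gr}
    (ha : ∀ k, a k ∈ Gr.part (α k)) :
    oprod (a ∘ Equiv.swap k.castSucc k.succ)
      = sgn (α k.castSucc * α k.succ) • oprod a := by
  induction r with
  | zero => exact k.elim0
  | succ r ih =>
    refine Fin.cases ?_ (fun k => ?_) k
    · rw [oprod_succ, oprod_succ, oprod_succ a, oprod_succ (fun k => a k.succ)]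
      have h1 : ∀ l : Fin r, Equiv.swap (0 : Fin (r + 2)) 1 l.succ.succ = l.succ.succ :=
        fun l => Equiv.swap_apply_of_ne_of_ne (Fin.succ_ne_zero _)
          (fun h => Fin.succ_ne_zero l (Fin.succ_injective _ h))
      simp [h1]
      rw [← mul_assoc, ← mul_assoc, comm_of_mem (ha 0) (ha 1)]
      simp
    · rw [oprod_succ, oprod_succ a]
      have h0 : Equiv.swap k.succ.castSucc k.succ.succ 0 = 0 :=
        Equiv.swap_apply_of_ne_of_ne (by rw [← Fin.succ_castSucc]; exact (Fin.succ_ne_zero _).symm)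
          (Fin.succ_ne_zero _).symm
      have h1 : ∀ l : Fin (r + 1), Equiv.swap k.succ.castSucc k.succ.succ l.succ
          = (Equiv.swap k.castSucc k.succ l).succ := fun l => by
        rw [← Fin.succ_castSucc]
        exact ((Fin.succ_injective _).swap_apply _ _ _)
      have h2 := ih k (α := fun l => α l.succ) (a := fun l => a l.succ) fun l => ha l.succ
      simp only [Function.comp_apply, h0, h1, Function.comp_def] at h2 ⊢
      rw [h2]
      simp

theorem inv_swap {r : ℕ} (k : Fin r) (α : Fin (r + 1) → ZMod 2) :
    inv (Equiv.swap k.castSucc k.succ) α = α k.castSucc * α k.succ := by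
  have h : ∀ a b : Fin (r + 1), a < b →
      Equiv.swap k.castSucc k.succ b < Equiv.swap k.castSucc k.succ a →
      a = k.castSucc ∧ b = k.succ := by
    intro a b hab h
    simp only [Equiv.swap_apply_def, Fin.ext_iff, Fin.lt_def, Fin.val_castSucc, Fin.val_succ] at *
    split_ifs at h <;> simp_all <;> omega
  unfold inv
  rw [Finset.sum_eq_single k.castSucc, Finset.sum_eq_single k.succ]
  · rw [if_pos]; simp
  · intro b hb hne
    rw [if_neg]
    exact fun h1 => hne (h _ _ (Finset.mem_Ioi.1 hb) h1).2
  · intro h1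
    exact absurd (Finset.mem_Ioi.2 (Fin.castSucc_lt_succ)) h1
  · intro a _ hne
    refine Finset.sum_eq_zero fun b hb => ?_
    rw [if_neg]
    exact fun h1 => hne (h _ _ (Finset.mem_Ioi.1 hb) h1).1
  · simp

/-- By the cocycle rule `inv_mul` the claim is stable under products, and adjacent transpositions
generate the symmetric group as a monoid. -/
theorem oprod_perm {r : ℕ} (σ : Equiv.Perm (Fin r)) {α : Fin r → ZMod 2} {a : Fin r → Gr}
    (ha : ∀ k, a k ∈ Gr.part (α k)) :
    oprod (a ∘ σ) = sgn (inv σ (α ∘ σ)) • oprod a := by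
  cases r with
  | zero => simp [oprod_zero, inv, sgn_zero]
  | succ r =>
    have h : σ ∈ Submonoid.closure
        (Set.range fun i : Fin r => Equiv.swap i.castSucc i.succ) := by
      rw [Equiv.Perm.mclosure_swap_castSucc_succ]; trivial
    induction h using Submonoid.closure_induction generalizing α a with
    | mem σ hσ =>
      obtain ⟨k, rfl⟩ := hσ
      rw [oprod_swap k ha, inv_swap]
      simp [mul_comm]
    | one =>
      have : (α ∘ (1 : Equiv.Perm (Fin (r + 1)))) = α := rfl
      rw [this, inv_one, sgn_zero, one_smul]; rfl
    | mul σ τ _ _ h1 h2 =>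
      have h3 : a ∘ (σ * τ) = (a ∘ σ) ∘ τ := rfl
      have h4 : (α ∘ (σ * τ)) ∘ τ.symm = α ∘ σ := by ext; simp
      rw [h3, h2 (α := α ∘ σ) (a := a ∘ σ) (fun k => ha (σ k)), h1 ha, inv_mul, h4, sgn_add, mul_smul]
      rfl

/-- For a `g` that is not symmetric, a pair inverted by π has its arguments exchanged. -/
theorem sum_pairs_comp_symm {r : ℕ} {M : Type*} [AddCommMonoid M] (π : Equiv.Perm (Fin r))
    (g : Fin r → Fin r → M) :
    ∑ k, ∑ l ∈ Finset.Ioi k, g (π.symm k) (π.symm l)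
      = ∑ a, ∑ b ∈ Finset.Ioi a, if π b < π a then g b a else g a b := by
  rw [← sum_pairs_comp π.symm (fun a b => if π b < π a then g b a else g a b)]
  · refine Finset.sum_congr rfl fun a _ => Finset.sum_congr rfl fun b hb => ?_
    rw [Finset.mem_Ioi] at hb
    simp [hb.not_gt]
  · intro a b
    rcases lt_trichotomy (π a) (π b) with h | h | h
    · simp [h, h.not_gt]
    · rw [π.injective h]
    · simp [h, h.not_gt]

/-! ### Products with fresh generators -/

/-- An element involves only finitely many generators; this is detected by contraction with the
coordinate forms. -/
theorem eventually_contractRight (x : Gr) :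
    ∃ N : ℕ, ∀ n, N ≤ n →
      CliffordAlgebra.contractRight x (Finsupp.lapply n : (ℕ →₀ ℂ) →ₗ[ℂ] ℂ) = 0 := by
  induction x using CliffordAlgebra.right_induction with
  | algebraMap r => exact ⟨0, fun n _ => CliffordAlgebra.contractRight_algebraMap _ _ _⟩
  | add x y hx hy =>
    obtain ⟨N, hN⟩ := hx
    obtain ⟨M, hM⟩ := hy
    refine ⟨max N M, fun n hn => ?_⟩
    rw [map_add, LinearMap.add_apply, hN n (by omega), hM n (by omega), add_zero]
  | mul_ι v x hx =>
    obtain ⟨N, hN⟩ := hx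
    refine ⟨max N (v.support.sup id + 1), fun n hn => ?_⟩
    have hv : v n = 0 := by
      by_contra h
      have : n ≤ v.support.sup id := Finset.le_sup (f := id) (Finsupp.mem_support_iff.2 h)
      omega
    rw [CliffordAlgebra.contractRight_mul_ι, hN n (by omega)]
    simp [hv]

/-- Contracting `x * ι v` with the coordinate of a fresh generator `v` recovers `x`. This is where
infinitely many generators are needed. -/
theorem exists_mul_ι_ne_zero {x : Gr} (hx : x ≠ 0) :
    ∃ v : ℕ →₀ ℂ, x * ExteriorAlgebra.ι ℂ v ≠ 0 := by
  obtain ⟨N, hN⟩ := eventually_contractRight x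
  refine ⟨Finsupp.single N 1, fun h => hx ?_⟩
  have h1 := CliffordAlgebra.contractRight_mul_ι (Q := (0 : QuadraticForm ℂ (ℕ →₀ ℂ)))
    (Finsupp.lapply N : (ℕ →₀ ℂ) →ₗ[ℂ] ℂ) (Finsupp.single N 1) x
  change x * CliffordAlgebra.ι 0 (Finsupp.single N 1) = 0 at h
  rw [h, hN N le_rfl] at h1
  simpa using h1.symm

/-- Two fresh generators give the even square-zero `s`; θ is 1 or a third one, according to α. -/
theorem exists_mul_square_zero_ne_zero {x : Gr} (hx : x ≠ 0) (α : ZMod 2) :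
    ∃ s ∈ Gr.part 0, ∃ θ ∈ Gr.part α, s * s = 0 ∧ x * (s * θ) ≠ 0 := by
  obtain ⟨v, hv⟩ := exists_mul_ι_ne_zero hx
  obtain ⟨w, hw⟩ := exists_mul_ι_ne_zero hv
  have hs := CliffordAlgebra.ι_mul_ι_mem_evenOdd_zero (0 : QuadraticForm ℂ (ℕ →₀ ℂ)) v w
  have hss : (ExteriorAlgebra.ι ℂ v * ExteriorAlgebra.ι ℂ w : Gr)
      * (ExteriorAlgebra.ι ℂ v * ExteriorAlgebra.ι ℂ w) = 0 := by
    rw [mul_assoc, ← mul_assoc (ExteriorAlgebra.ι ℂ w), ι_mul_eq w (ExteriorAlgebra.ι ℂ v),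
      mul_assoc, ExteriorAlgebra.ι_sq_zero, mul_zero, mul_zero]
  rcases ZMod2.eq_zero_or_one α with rfl | rfl
  · refine ⟨_, hs, 1, one_mem_part, hss, ?_⟩
    rw [mul_one, ← mul_assoc]
    exact hw
  · obtain ⟨u, hu⟩ := exists_mul_ι_ne_zero hw
    refine ⟨_, hs, _, CliffordAlgebra.ι_mem_evenOdd_one _ u, hss, ?_⟩
    rw [← mul_assoc, ← mul_assoc]
    exact hu

theorem exists_mul_oprod_ne_zero {x : Gr} (hx : x ≠ 0) {r : ℕ} (α : Fin r → ZMod 2) :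
    ∃ s θ : Fin r → Gr, (∀ k, s k ∈ Gr.part 0) ∧ (∀ k, θ k ∈ Gr.part (α k)) ∧
      (∀ k, s k * s k = 0) ∧ x * oprod (fun k => s k * θ k) ≠ 0 := by
  induction r generalizing x with
  | zero => exact ⟨Fin.elim0, Fin.elim0, fun k => k.elim0, fun k => k.elim0, fun k => k.elim0, by
      simpa [oprod_zero] using hx⟩
  | succ r ih =>
    obtain ⟨s, hs, θ, hθ, hss, hne⟩ := exists_mul_square_zero_ne_zero hx (α 0)
    obtain ⟨s', θ', h1, h2, h3, h4⟩ := ih hne fun k => α k.succ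
    refine ⟨Fin.cons s s', Fin.cons θ θ', ?_, ?_, ?_, ?_⟩
    · exact Fin.cases hs h1
    · exact Fin.cases hθ h2
    · exact Fin.cases hss h3
    · rw [oprod_succ]
      simpa [mul_assoc] using h4

/-! ### Tensor powers of endomorphisms -/

theorem tprod_apply {J : Type*} (q : J → ZMod 2) {r : ℕ} (x : Fin r → Mod J) (i : Fin r → J) :
    tprod q x i = oprod fun k => tw (∑ l ∈ Finset.Ioi k, q (i l)) (x k (i k)) := rfl

section Space

variable {I : Type*} [Fintype I] [DecidableEq I] (p : I → ZMod 2) (η : Matrix I I ℂ)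

theorem varpi_apply {r : ℕ} (π : Equiv.Perm (Fin r)) (x : Tens r I) (j : Fin r → I) :
    varpi p π x j = sgn (inv π (p ∘ j ∘ π)) • x (j ∘ π) := rfl

theorem varpi_mul {r : ℕ} (π σ : Equiv.Perm (Fin r)) (x : Tens r I) :
    varpi p (π * σ) x = varpi p π (varpi p σ x) := by
  ext j
  have h : (p ∘ j ∘ ⇑(π * σ)) ∘ σ.symm = p ∘ j ∘ π := by ext; simp
  rw [varpi_apply, varpi_apply, varpi_apply, smul_smul, inv_mul, h, sgn_add, mul_comm]
  rfl

theorem varpi_symm_apply {r : ℕ} (π : Equiv.Perm (Fin r)) (x : Tens r I) (j : Fin r → I) :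
    varpi p π x (j ∘ π.symm) = sgn (inv π (p ∘ j)) • x j := by
  have h : (j ∘ π.symm) ∘ π = j := by ext; simp
  rw [varpi_apply, h]

/-- Right linear maps are determined by their values on the basis vectors. -/
theorem linearMap_ext_e {J N : Type*} [Fintype J] [DecidableEq J] [AddCommMonoid N]
    [Module Grᵐᵒᵖ N]
    {f g : Mod J →ₗ[Grᵐᵒᵖ] N} (h : ∀ j, f (e j) = g (e j)) : f = g := by
  refine LinearMap.pi_ext fun j x => ?_
  have : (Pi.single j x : Mod J) = MulOpposite.op x • e j := by
    ext k
    by_cases hk : k = j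
    · subst hk; simp [e]
    · simp [e, hk]
  rw [this, map_smul, map_smul, h]

theorem linearMap_apply_eq {J : Type*} [Fintype J] [DecidableEq J]
    (f : Mod J →ₗ[Grᵐᵒᵖ] Gr) (x : Mod J) : f x = ∑ j, f (e j) * x j := by
  have h : f = ∑ j, (LinearMap.toSpanSingleton Grᵐᵒᵖ Gr (f (e j))).comp
      ({ toFun := fun x => MulOpposite.op (x j), map_add' := fun _ _ => rfl,
         map_smul' := fun _ _ => by simp } : Mod J →ₗ[Grᵐᵒᵖ] Grᵐᵒᵖ) := by
    refine linearMap_ext_e fun j => ?_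
    simp only [LinearMap.sum_apply, LinearMap.comp_apply]
    rw [Finset.sum_eq_single j]
    · simp [e]
    · intro k _ hk
      simp [e, hk]
    · simp
  conv_lhs => rw [h]
  simp

theorem endV_apply_eq (A : EndV I) (x : Mod I) (a : I) : A x a = ∑ b, A (e b) a * x b :=
  linearMap_apply_eq ((LinearMap.proj a).comp A) x

theorem tprod_e {J : Type*} [DecidableEq J] (q : J → ZMod 2) {r : ℕ} (j : Fin r → J) :
    tprod q (fun k => e (j k)) = e j := by
  ext i
  rw [tprod_apply]
  by_cases h : i = j
  · subst h
    simp [e, oprod_one]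
  · obtain ⟨k, hk⟩ := Function.ne_iff.1 h
    rw [oprod_eq_zero k (by simp [e, hk])]
    simp [e, h]

/-- The tensor power of an endomorphism. -/
def tpow {r : ℕ} (A : EndV I) : Tens r I →ₗ[Grᵐᵒᵖ] Tens r I where
  toFun x := fun i => ∑ j, tprod p (fun k => A (e (j k))) i * x j
  map_add' x y := by ext i; simp [mul_add, Finset.sum_add_distrib]
  map_smul' c x := by ext i; simp [Finset.sum_mul, mul_assoc]

theorem tpow_e {r : ℕ} (A : EndV I) (j : Fin r → I) :
    tpow p A (e j) = tprod p fun k => A (e (j k)) := by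
  ext i
  simp [tpow, e, Pi.single_apply]

/-- An even A has entries of parity `p i + p j`. Moving the coefficient of a vector past the later
entries changes its twist from the output indices `i` to the input indices `j`. -/
theorem tpow_tprod {r : ℕ} {A : EndV I} (hA : IsEven p A) (v : Fin r → Mod I) :
    tpow p A (tprod p v) = tprod p fun k => A (v k) := by
  ext i
  rw [tprod_apply]
  simp only [endV_apply_eq A (v _), map_sum, oprod_sum, map_mul]
  refine Finset.sum_congr rfl fun j _ => ?_
  rw [oprod_mul (fun k => tw_mem (hA (i k) (j k)))]
  simp only [tprod_apply, tw_tw]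
  congr 2
  ext1 k
  congr 2
  rw [Finset.sum_add_distrib]
  linear_combination - ZMod2.add_self (∑ l ∈ Finset.Ioi k, p (i l))

theorem oprod_tw {r : ℕ} {α : Fin r → ZMod 2} {x : Fin r → Gr} (hx : ∀ k, x k ∈ Gr.part (α k))
    (β : Fin r → ZMod 2) :
    oprod (fun k => tw (β k) (x k)) = sgn (∑ k, β k * α k) • oprod x := by
  simp only [tw_of_mem _ (hx _), oprod_smul, sgn_sum]

theorem tprod_of_mem {J : Type*} (q : J → ZMod 2) {r : ℕ} {v : Fin r → Mod J} {i : Fin r → J}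
    {α : Fin r → ZMod 2} (hv : ∀ k, v k (i k) ∈ Gr.part (α k)) :
    tprod q v i
      = sgn (∑ k, ∑ l ∈ Finset.Ioi k, q (i l) * α k) • oprod fun k => v k (i k) := by
  rw [tprod_apply, oprod_tw hv]
  simp only [Finset.sum_mul]

/-- The homogeneous elements of parity `ν` of `Mod J`. -/
def IsHomog {J : Type*} (q : J → ZMod 2) (ν : ZMod 2) (v : Mod J) : Prop :=
  ∀ a, v a ∈ Gr.part (ν + q a)

theorem isHomog_e {J : Type*} [DecidableEq J] (q : J → ZMod 2) (j : J) :
    IsHomog q (q j) (e j) := by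
  intro a
  by_cases h : a = j
  · subst h
    rw [ZMod2.add_self]
    simpa [e] using one_mem_part
  · simp [e, h]

theorem IsEven.isHomog {A : EndV I} (hA : IsEven p A) (b : I) : IsHomog p (p b) (A (e b)) := by
  intro a
  rw [add_comm]
  exact hA a b

/-- `varpi` is defined by signs on basis vectors; permuting the coefficients as well (`oprod_perm`)
turns these into signs in the total parities ν. -/
theorem varpi_tprod {r : ℕ} (π : Equiv.Perm (Fin r)) {v : Fin r → Mod I} {ν : Fin r → ZMod 2}
    (hv : ∀ k, IsHomog p (ν k) (v k)) :
    varpi p π (tprod p v) = sgn (inv π ν) • tprod p (v ∘ π.symm) := by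
  suffices h : ∀ i : Fin r → I, varpi p π (tprod p v) (i ∘ π.symm)
      = (sgn (inv π ν) • tprod p (v ∘ π.symm)) (i ∘ π.symm) by
    ext i
    have h1 := h (i ∘ π)
    have h2 : (i ∘ π) ∘ π.symm = i := by ext; simp
    rwa [h2] at h1
  intro i
  rw [varpi_symm_apply, Pi.smul_apply, tprod_of_mem p fun k => hv k (i k),
    tprod_of_mem p (v := v ∘ π.symm) (i := i ∘ π.symm) fun k => hv (π.symm k) (i (π.symm k))]
  have h1 := oprod_perm π.symm fun k => hv k (i k)
  have h2 : oprod (fun k => (v ∘ π.symm) k ((i ∘ π.symm) k))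
      = oprod ((fun k => v k (i k)) ∘ π.symm) := rfl
  have h3 : inv π.symm ((fun k => ν k + p (i k)) ∘ π.symm) = inv π fun k => ν k + p (i k) :=
    inv_symm π _
  rw [h2, h1, h3, smul_smul, smul_smul, smul_smul, ← sgn_add, ← sgn_add, ← sgn_add]
  congr 2
  have h4 := sum_pairs_comp_symm π fun a b => p (i b) * (ν a + p (i a))
  simp only [Function.comp_apply, h4]
  simp only [inv, ← Finset.sum_add_distrib]
  refine Finset.sum_congr rfl fun a _ => Finset.sum_congr rfl fun b _ => ?_
  simp only [Function.comp_apply]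
  -- All signs are sums over pairs, so the comparison is a finite check in `ZMod 2` for each pair.
  generalize p (i a) = x, p (i b) = y, ν a = z, ν b = w
  split_ifs
  · revert x y z w; decide
  · ring

theorem varpi_e {r : ℕ} (π : Equiv.Perm (Fin r)) (m : Fin r → I) :
    varpi p π (e m) = sgn (inv π (p ∘ m)) • (e (m ∘ π.symm) : Tens r I) := by
  rw [← tprod_e p m, varpi_tprod p π fun k => isHomog_e p (m k), ← tprod_e p]
  rfl

/-- A preserves the parity of each basis vector, so permuting before or after A costs the same sign.
-/
theorem varpi_tpow {r : ℕ} (π : Equiv.Perm (Fin r)) {A : EndV I} (hA : IsEven p A)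
    (x : Tens r I) : varpi p π (tpow p A x) = tpow p A (varpi p π x) := by
  suffices h : (varpi p π).comp (tpow p A) = (tpow p A).comp (varpi p π) from
    LinearMap.congr_fun h x
  refine linearMap_ext_e fun m => ?_
  rw [LinearMap.comp_apply, LinearMap.comp_apply, varpi_e, tpow_e, LinearMap.map_smul_of_tower, tpow_e,
    varpi_tprod p π fun k => hA.isHomog p (m k)]
  rfl

end Space
/-! ### The blocks `{2k - 1, 2k}` -/

/-- The position in the `k`-th block. -/
def pos {d : ℕ} (k : Fin d) (x : Bool) : Fin (2 * d) := if x then pos2 k else pos1 k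

theorem pos_val {d : ℕ} (k : Fin d) (x : Bool) : (pos k x).1 = 2 * k.1 + if x then 1 else 0 := by
  cases x <;> rfl

theorem pos_injective {d : ℕ} {k l : Fin d} {x y : Bool} (h : pos k x = pos l y) :
    k = l ∧ x = y := by
  have h1 := congrArg Fin.val h
  rw [pos_val, pos_val] at h1
  cases x <;> cases y <;> simp [Fin.ext_iff] at * <;> omega

theorem pos_lt_pos {d : ℕ} {k l : Fin d} {x y : Bool} (hkl : k ≠ l) :
    pos k x < pos l y ↔ k < l := by
  rw [Fin.lt_def, Fin.lt_def, pos_val, pos_val]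
  have : k.1 ≠ l.1 := fun h => hkl (Fin.ext h)
  cases x <;> cases y <;> simp <;> omega

/-- The decomposition of `{1, …, 2d}` into blocks. -/
def blockEquiv (d : ℕ) : Fin d × Bool ≃ Fin (2 * d) where
  toFun kx := pos kx.1 kx.2
  invFun a := (⟨a.1 / 2, by omega⟩, decide (a.1 % 2 = 1))
  left_inv := by
    rintro ⟨k, x⟩
    cases x <;> simp [pos_val, Fin.ext_iff]
    omega
  right_inv := by
    intro a
    rw [Fin.ext_iff, pos_val]
    rcases Nat.mod_two_eq_zero_or_one a.1 with h | h <;> simp [h] <;> omega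

theorem blockEquiv_symm_pos {d : ℕ} (k : Fin d) (x : Bool) :
    (blockEquiv d).symm (pos k x) = (k, x) := (blockEquiv d).symm_apply_apply (k, x)

theorem exists_pos {d : ℕ} (a : Fin (2 * d)) : ∃ k x, a = pos k x :=
  ⟨_, _, ((blockEquiv d).apply_symm_apply a).symm⟩

theorem sum_blocks {d : ℕ} {M : Type*} [AddCommMonoid M] (f : Fin (2 * d) → M) :
    ∑ a, f a = ∑ k, (f (pos k false) + f (pos k true)) := by
  rw [← (blockEquiv d).sum_comp, Fintype.sum_prod_type]
  refine Finset.sum_congr rfl fun k _ => ?_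
  rw [Fintype.sum_bool, add_comm]
  rfl

theorem sum_pairs_blocks {d : ℕ} {M : Type*} [AddCommMonoid M] (g : Fin (2 * d) → Fin (2 * d) → M) :
    ∑ a, ∑ b ∈ Finset.Ioi a, g a b = ∑ k, g (pos k false) (pos k true)
      + ∑ k, ∑ l ∈ Finset.Ioi k, (g (pos k false) (pos l false) + g (pos k false) (pos l true)
        + (g (pos k true) (pos l false) + g (pos k true) (pos l true))) := by
  simp only [sum_Ioi_eq, sum_blocks]
  rw [← Finset.sum_add_distrib]
  refine Finset.sum_congr rfl fun k _ => ?_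
  have h : g (pos k false) (pos k true)
      = ∑ l, if l = k then g (pos k false) (pos k true) else 0 := by simp
  rw [h, ← Finset.sum_add_distrib, ← Finset.sum_add_distrib]
  refine Finset.sum_congr rfl fun l _ => ?_
  by_cases hl : l = k
  · subst hl
    simp [Fin.lt_def, pos_val]
  · have hl' : k ≠ l := fun h => hl h.symm
    simp only [pos_lt_pos hl', if_neg hl, zero_add]
    split_ifs <;> simp

theorem oprod_blocks {d : ℕ} (x : Fin (2 * d) → Gr) :
    oprod x = oprod fun k => x (pos k false) * x (pos k true) := by
  unfold oprod
  rw [List.ofFn_mul', List.prod_flatten, List.map_ofFn]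
  congr 2
  ext1 k
  simp [List.ofFn_succ]
  rfl

/-- The blocks of a multi-index. -/
def blocks {I : Type*} {d : ℕ} : (Fin (2 * d) → I) ≃ (Fin d → I × I) where
  toFun i k := (i (pos k false), i (pos k true))
  invFun j a := if ((blockEquiv d).symm a).2 then (j ((blockEquiv d).symm a).1).2
    else (j ((blockEquiv d).symm a).1).1
  left_inv i := by
    ext a
    obtain ⟨k, x, rfl⟩ := exists_pos a
    dsimp only
    rw [blockEquiv_symm_pos]
    cases x <;> rfl
  right_inv j := by
    ext k <;> simp [blockEquiv_symm_pos]

theorem blocks_apply {I : Type*} {d : ℕ} (i : Fin (2 * d) → I) (k : Fin d) :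
    blocks i k = (i (pos k false), i (pos k true)) := rfl

/-- `σ` permutes the blocks by `τ`, and swaps the points of the `k`-th block if `ε k`. -/
def IsBlockPerm {d : ℕ} (σ : Equiv.Perm (Fin (2 * d))) (τ : Equiv.Perm (Fin d))
    (ε : Fin d → Bool) : Prop :=
  ∀ k x, σ (pos k x) = pos (τ k) (xor (ε k) x)

theorem pairInvolution_pos {d : ℕ} (k : Fin d) (x : Bool) :
    pairInvolution d (pos k x) = pos k (!x) := by
  change dite _ _ _ = _
  rw [Fin.ext_iff]
  cases x <;> simp [pos_val]

theorem mem_centr_iff {d : ℕ} {σ : Equiv.Perm (Fin (2 * d))} :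
    σ ∈ centr d ↔ σ * pairInvolution d = pairInvolution d * σ :=
  Subgroup.mem_centralizer_singleton_iff

/-- A permutation commuting with the involution permutes its orbits, the blocks: C is the wreath
product of ℤ/2 with the symmetric group on `d` letters. -/
theorem exists_isBlockPerm {d : ℕ} {σ : Equiv.Perm (Fin (2 * d))} (hσ : σ ∈ centr d) :
    ∃ τ ε, IsBlockPerm σ τ ε := by
  rw [mem_centr_iff] at hσ
  have h1 : ∀ k, ∃ l y, σ (pos k false) = pos l y := fun k => exists_pos _
  choose τ ε h using h1
  have h2 : ∀ k x, σ (pos k x) = pos (τ k) (xor (ε k) x) := by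
    intro k x
    cases x
    · simp [h]
    · have := congrArg (fun π : Equiv.Perm _ => π (pos k false)) hσ
      simp only [Equiv.Perm.mul_apply, h, pairInvolution_pos] at this
      simpa using this
  have h3 : Function.Injective τ := by
    intro k l hkl
    have h4 : σ (pos k (ε k)) = σ (pos l (ε l)) := by rw [h2, h2, hkl]; simp
    exact (pos_injective (σ.injective h4)).1
  exact ⟨Equiv.ofBijective τ (Finite.injective_iff_bijective.1 h3), ε, h2⟩

theorem exists_mem_centr {d : ℕ} (τ : Equiv.Perm (Fin d)) (ε : Fin d → Bool) :
    ∃ σ ∈ centr d, IsBlockPerm σ τ ε := by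
  let s : Equiv.Perm (Fin d × Bool) :=
    { toFun := fun kx => (τ kx.1, xor (ε kx.1) kx.2)
      invFun := fun kx => (τ.symm kx.1, xor (ε (τ.symm kx.1)) kx.2)
      left_inv := fun kx => by simp
      right_inv := fun kx => by simp }
  have h : IsBlockPerm ((blockEquiv d).permCongr s) τ ε := by
    intro k x
    rw [Equiv.permCongr_apply, blockEquiv_symm_pos]
    rfl
  refine ⟨_, ?_, h⟩
  rw [mem_centr_iff]
  ext1 a
  obtain ⟨k, x, rfl⟩ := exists_pos a
  rw [Equiv.Perm.mul_apply, Equiv.Perm.mul_apply, pairInvolution_pos, h, h, pairInvolution_pos]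
  simp

/-- Inversions lie within a swapped block, or between two blocks that cross; crossing blocks
contribute all four products, that is, the product of the block parities. -/
theorem IsBlockPerm.inv_eq {d : ℕ} {σ : Equiv.Perm (Fin (2 * d))} {τ : Equiv.Perm (Fin d)}
    {ε : Fin d → Bool} (h : IsBlockPerm σ τ ε) (α : Fin (2 * d) → ZMod 2) :
    inv σ α = ∑ k, (if ε k then α (pos k false) * α (pos k true) else 0)
      + inv τ fun k => α (pos k false) + α (pos k true) := by
  rw [inv, sum_pairs_blocks, inv]
  congr 1
  · refine Finset.sum_congr rfl fun k _ => ?_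
    rw [h, h]
    cases ε k <;> simp [Fin.lt_def, pos_val]
  · refine Finset.sum_congr rfl fun k _ => Finset.sum_congr rfl fun l hl => ?_
    have h1 : τ l ≠ τ k := fun h => (Finset.mem_Ioi.1 hl).ne' (τ.injective h)
    simp only [h k, h l, pos_lt_pos h1]
    split_ifs
    · ring
    · simp

theorem IsBlockPerm.blocks_comp_symm {I : Type*} {d : ℕ} {σ : Equiv.Perm (Fin (2 * d))}
    {τ : Equiv.Perm (Fin d)} {ε : Fin d → Bool} (h : IsBlockPerm σ τ ε) (i : Fin (2 * d) → I)
    (k : Fin d) :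
    blocks (i ∘ σ.symm) (τ k) = if ε k then (blocks i k).swap else blocks i k := by
  have h1 : ∀ x, σ.symm (pos (τ k) (xor (ε k) x)) = pos k x := fun x => by
    rw [← h, Equiv.symm_apply_apply]
  have h2 := h1 true
  have h3 := h1 false
  cases hk : ε k <;> simp [hk] at h2 h3 <;> simp [blocks_apply, h2, h3]

/-! ### The centraliser acting on block tensors and on the bracket -/

section Space

variable {I : Type*} [Fintype I] [DecidableEq I] (p : I → ZMod 2) (η : Matrix I I ℂ)

/-- The parity of a basis element of `V^* ⊗ V^*`. -/
def parP (ab : I × I) : ZMod 2 := p ab.1 + p ab.2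

/-- `t 0 ⊗ ⋯ ⊗ t (d - 1)` for elements of `V^* ⊗ V^*`. -/
def tensProd {d : ℕ} (t : Fin d → Mod (I × I)) : Tens (2 * d) I :=
  fun i => tprod (parP p) t (blocks i)

theorem tensPow_eq (d : ℕ) (t : Mod (I × I)) : tensPow p d t = tensProd p fun _ => t := rfl

/-- The signed flip of the factors of `V^* ⊗ V^*`. -/
def flip (t : Mod (I × I)) : Mod (I × I) := fun ab => sgn (p ab.1 * p ab.2) • t ab.swap

/-- The factors `t k` are even, so moving whole blocks costs no sign; a swap inside a block is the
signed flip. -/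
theorem varpi_tensProd {d : ℕ} {σ : Equiv.Perm (Fin (2 * d))} {τ : Equiv.Perm (Fin d)}
    {ε : Fin d → Bool} (h : IsBlockPerm σ τ ε) {t : Fin d → Mod (I × I)}
    (ht : ∀ k, IsHomog (parP p) 0 (t k)) :
    varpi p σ (tensProd p t)
      = tensProd p ((fun k => if ε k then flip p (t k) else t k) ∘ τ.symm) := by
  suffices h0 : ∀ i : Fin (2 * d) → I, varpi p σ (tensProd p t) (i ∘ σ.symm)
      = tensProd p ((fun k => if ε k then flip p (t k) else t k) ∘ τ.symm) (i ∘ σ.symm) by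
    ext i
    have h1 := h0 (i ∘ σ)
    have h2 : (i ∘ σ) ∘ σ.symm = i := by ext; simp
    rwa [h2] at h1
  intro i
  have ht' : ∀ k, IsHomog (parP p) 0 (if ε k then flip p (t k) else t k) := by
    intro k
    split_ifs
    · intro ab
      refine Submodule.smul_mem _ _ ?_
      have := ht k ab.swap
      simpa [parP, add_comm] using this
    · exact ht k
  -- The block permutation τ acts on tensors over `I × I`; the total parities 0 make its sign
  -- trivial.
  have h1 := congrFun (varpi_tprod (parP p) τ ht') (blocks (i ∘ σ.symm))
  have h2 : inv τ (fun _ => 0) = 0 := by simp [inv]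
  rw [h2, sgn_zero, one_smul] at h1
  have h3 : parP p ∘ blocks (i ∘ σ.symm) ∘ τ = fun k => p (i (pos k false)) + p (i (pos k true)) := by
    ext1 k
    simp only [Function.comp_apply, h.blocks_comp_symm]
    split_ifs <;> simp [parP, blocks_apply, add_comm]
  rw [varpi_symm_apply, h.inv_eq]
  unfold tensProd
  rw [← h1, varpi_apply, h3, sgn_add, mul_comm, mul_smul]
  congr 1
  rw [tprod_apply, tprod_apply, sgn_sum, ← oprod_smul]
  congr 1
  ext1 k
  have h4 : ∀ l, parP p ((blocks (i ∘ σ.symm) ∘ τ) l) = parP p (blocks i l) := by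
    intro l
    simp only [Function.comp_apply, h.blocks_comp_symm]
    split_ifs <;> simp [parP, blocks_apply, add_comm]
  simp only [h4]
  rw [← map_smul]
  congr 1
  simp only [Function.comp_apply, h.blocks_comp_symm]
  cases ε k
  · simp [sgn_zero]
  · simp [flip, blocks_apply, mul_comm]

theorem bracket_e {d : ℕ} (m : Fin (2 * d) → I) :
    bracket η d (e m) = (∏ k : Fin d, η (m (pos k false)) (m (pos k true))) • 1 := by
  change ∑ i : Fin (2 * d) → I, (∏ k : Fin d, η (i (pos k false)) (i (pos k true)))
    • (e m : Tens (2 * d) I) i = _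
  simp [e, Pi.single_apply]

variable {p η}

/-- Swaps inside a block are absorbed by supersymmetry. If some pair has mixed parity both sides
vanish; otherwise all blocks are even and permuting them costs no sign. -/
theorem bracket_varpi (hη : IsOrthosymplectic p η) {d : ℕ} {σ : Equiv.Perm (Fin (2 * d))}
    (hσ : σ ∈ centr d) (x : Tens (2 * d) I) : bracket η d (varpi p σ x) = bracket η d x := by
  obtain ⟨τ, ε, h⟩ := exists_isBlockPerm hσ
  suffices h : (bracket η d).comp (varpi p σ) = bracket η d from LinearMap.congr_fun h x
  refine linearMap_ext_e fun m => ?_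
  rw [LinearMap.comp_apply, varpi_e, LinearMap.map_smul_of_tower, bracket_e, bracket_e, smul_smul]
  congr 1
  rw [← Equiv.prod_comp τ fun k => η ((m ∘ σ.symm) (pos k false)) ((m ∘ σ.symm) (pos k true))]
  have h1 : ∀ k, η ((m ∘ σ.symm) (pos (τ k) false)) ((m ∘ σ.symm) (pos (τ k) true))
      = sgn (if ε k then p (m (pos k false)) * p (m (pos k true)) else 0)
        * η (m (pos k false)) (m (pos k true)) := by
    intro k
    have h2 := h.blocks_comp_symm m k
    rw [blocks_apply, blocks_apply, Prod.ext_iff] at h2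
    dsimp only at h2
    rw [h2.1, h2.2]
    cases ε k
    · simp [sgn_zero]
    · simp [hη.supersymm (m (pos k true)), mul_comm]
  rw [Finset.prod_congr rfl fun k _ => h1 k, Finset.prod_mul_distrib, h.inv_eq, sgn_add, sgn_sum]
  by_cases h2 : ∀ k, p (m (pos k false)) = p (m (pos k true))
  · have h3 : inv τ (fun k => (p ∘ m) (pos k false) + (p ∘ m) (pos k true)) = 0 := by
      simp [inv, h2, ZMod2.add_self]
    rw [h3, sgn_zero, mul_one, ← mul_assoc]
    simp only [Function.comp_apply, ← Finset.prod_mul_distrib, sgn_mul_self, one_mul]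
  · push Not at h2
    obtain ⟨k, hk⟩ := h2
    have h3 : ∏ k, η (m (pos k false)) (m (pos k true)) = 0 :=
      Finset.prod_eq_zero (Finset.mem_univ k) (hη.even _ _ hk)
    rw [h3, mul_zero, mul_zero]

end Space

section Space

variable {I : Type*} [Fintype I] [DecidableEq I] {p : I → ZMod 2} {η : Matrix I I ℂ}

/-! ### The form and adjoints -/

theorem form_eq (v w : Mod I) :
    form p η v w = ∑ a, ∑ b, η a b • (tw (p a) (v a) * w b) := rfl

theorem form_e_left (a : I) (w : Mod I) : form p η (e a) w = ∑ b, η a b • w b := by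
  rw [form_eq, Finset.sum_eq_single a]
  · simp [e]
  · intro c _ hc
    simp [e, hc]
  · simp

/-- The coefficient `v a` crosses the entries of `A (e a)`; together with the twist in the form this
leaves `tw (p a)`. -/
theorem form_map_left {A : EndV I} (hA : IsEven p A) (v w : Mod I) :
    form p η (A v) w = ∑ a, tw (p a) (v a) * form p η (A (e a)) w := by
  simp only [form_eq, Finset.mul_sum]
  conv_rhs => rw [Finset.sum_comm]
  refine Finset.sum_congr rfl fun c _ => ?_
  conv_rhs => rw [Finset.sum_comm]
  refine Finset.sum_congr rfl fun b _ => ?_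
  rw [endV_apply_eq A v, map_sum, Finset.sum_mul, Finset.smul_sum]
  refine Finset.sum_congr rfl fun a _ => ?_
  rw [mul_smul_comm, map_mul, ← mul_assoc, mul_of_mem (tw_mem (hA c a)) (tw (p a) (v a)), tw_tw]
  congr 5
  linear_combination - ZMod2.add_self (p a)

theorem isEven_one : IsEven p (1 : EndV I) := fun a b => by
  have := isHomog_e p b a
  rwa [add_comm] at this

theorem form_left (v w : Mod I) : form p η v w = ∑ a, tw (p a) (v a) * form p η (e a) w :=
  form_map_left isEven_one v w

theorem form_symm (hη : IsOrthosymplectic p η) {ν μ : ZMod 2} {v w : Mod I}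
    (hv : IsHomog p ν v) (hw : IsHomog p μ w) :
    form p η v w = sgn (ν * μ) • form p η w v := by
  rw [form_eq, form_eq, Finset.sum_comm, Finset.smul_sum]
  refine Finset.sum_congr rfl fun b _ => ?_
  rw [Finset.smul_sum]
  refine Finset.sum_congr rfl fun a _ => ?_
  by_cases hab : p a = p b
  · rw [hη.supersymm a b, tw_of_mem _ (hv a), tw_of_mem _ (hw b), smul_mul_assoc, smul_mul_assoc,
      comm_of_mem (hv a) (hw b), smul_smul, smul_smul, smul_smul, smul_smul, hab]
    congr 1
    rw [mul_comm (sgn _) (η b a), mul_comm (sgn (ν * μ)), mul_assoc, mul_assoc, mul_assoc,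
      ← sgn_add, ← sgn_add, ← sgn_add]
    congr 2
    generalize p b = x
    clear hv hw
    revert x ν μ; decide
  · rw [hη.even a b hab, hη.even b a (Ne.symm hab)]
    simp

theorem form_mem (hη : IsOrthosymplectic p η) {ν μ : ZMod 2} {v w : Mod I}
    (hv : IsHomog p ν v) (hw : IsHomog p μ w) : form p η v w ∈ Gr.part (ν + μ) := by
  refine Submodule.sum_mem _ fun a _ => Submodule.sum_mem _ fun b _ => ?_
  by_cases hab : p a = p b
  · refine Submodule.smul_mem _ _ ?_
    have h := mul_mem_part (tw_mem (a := p a) (hv a)) (hw b)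
    have h1 : ν + p a + (μ + p b) = ν + μ := by
      rw [hab]
      linear_combination ZMod2.add_self (p b)
    rwa [h1] at h
  · rw [hη.even a b hab]
    simp

theorem IsOrthosymplectic.mul_inv (hη : IsOrthosymplectic p η) : η * η⁻¹ = 1 :=
  Matrix.mul_nonsing_inv _ hη.nondegenerate

/-- Conjugation by the parity operator `diagonal (sgn ∘ p)` fixes η, hence η⁻¹, but negates the
entries between different parities. -/
theorem IsOrthosymplectic.inv_even (hη : IsOrthosymplectic p η) {a b : I} (hab : p a ≠ p b) :
    η⁻¹ a b = 0 := by
  have hD : Matrix.diagonal (sgn ∘ p) * Matrix.diagonal (sgn ∘ p) = (1 : Matrix I I ℂ) := by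
    rw [Matrix.diagonal_mul_diagonal, ← Matrix.diagonal_one]
    congr 1
    ext a
    exact sgn_mul_self _
  have h1 : Matrix.diagonal (sgn ∘ p) * η * Matrix.diagonal (sgn ∘ p) = η := by
    ext a b
    rw [Matrix.mul_diagonal, Matrix.diagonal_mul]
    by_cases hab : p a = p b
    · simp only [Function.comp_apply, hab]
      rw [mul_right_comm, sgn_mul_self, one_mul]
    · rw [hη.even a b hab]
      simp
  have h2 : Matrix.diagonal (sgn ∘ p) * η⁻¹ * Matrix.diagonal (sgn ∘ p) = η⁻¹ := by
    conv_rhs => rw [← h1, Matrix.mul_inv_rev, Matrix.mul_inv_rev, Matrix.inv_eq_left_inv hD]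
    rw [mul_assoc]
  have h3 := congrFun (congrFun h2 a) b
  rw [Matrix.mul_diagonal, Matrix.diagonal_mul] at h3
  simp only [Function.comp_apply] at h3
  have h4 : sgn (p a) * sgn (p b) = -1 := by
    rw [← sgn_add]
    have : p a + p b = 1 := by
      revert hab; generalize p a = x, p b = y; revert x y; decide
    rw [this, sgn_one]
  have h5 : sgn (p a) * η⁻¹ a b * sgn (p b) = - η⁻¹ a b := by
    rw [mul_right_comm, h4, neg_one_mul]
  rw [h5] at h3
  exact self_eq_neg.1 h3.symm

theorem dagger_apply (A : EndV I) (w : Mod I) (a : I) :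
    dagger p η A w a = ∑ b, η⁻¹ a b • form p η (A (e b)) w := rfl

theorem form_dagger (hη : IsOrthosymplectic p η) {A : EndV I} (hA : IsEven p A) (v w : Mod I) :
    form p η v (dagger p η A w) = form p η (A v) w := by
  rw [form_left, form_map_left hA]
  refine Finset.sum_congr rfl fun a _ => ?_
  congr 1
  rw [form_e_left]
  simp only [dagger_apply, Finset.smul_sum, smul_smul]
  rw [Finset.sum_comm]
  simp only [← Finset.sum_smul]
  have h : ∀ c, ∑ b, η a b * η⁻¹ b c = (1 : Matrix I I ℂ) a c := fun c => by
    rw [← hη.mul_inv, Matrix.mul_apply]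
  simp only [h, Matrix.one_apply]
  simp

theorem IsEven.mul {A B : EndV I} (hA : IsEven p A) (hB : IsEven p B) : IsEven p (A * B) := by
  intro a b
  rw [Module.End.mul_apply, endV_apply_eq]
  refine Submodule.sum_mem _ fun c _ => ?_
  have h := mul_mem_part (hA a c) (hB c b)
  have h1 : p a + p c + (p c + p b) = p a + p b := by
    linear_combination ZMod2.add_self (p c)
  rwa [h1] at h

theorem IsEven.dagger (hη : IsOrthosymplectic p η) {A : EndV I} (hA : IsEven p A) :
    IsEven p (dagger p η A) := by
  intro a b
  refine Submodule.sum_mem _ fun c _ => ?_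
  by_cases hac : p a = p c
  · rw [hac]
    exact Submodule.smul_mem _ _ (form_mem hη (hA.isHomog p c) (isHomog_e p b))
  · rw [hη.inv_even hac]
    simp

theorem IsEven.omega (hη : IsOrthosymplectic p η) {A : EndV I} (hA : IsEven p A) :
    IsEven p (omega p η A) := (hA.dagger hη).mul hA

theorem zetaInv_apply (B : EndV I) (a b : I) :
    zetaInv p η B (a, b) = tw (p a + p b) (form p η (B (e b)) (e a)) := by
  rw [zetaInv, Finset.sum_apply, Finset.sum_eq_single b]
  · rw [tmul, dualCoord, tw_tw, add_comm]
    simp [e, form]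
  · intro c _ hc
    rw [tmul]
    simp [e, hc.symm]
  · simp

theorem zetaInv_eq (hη : IsOrthosymplectic p η) {B : EndV I} (hB : IsEven p B) (a b : I) :
    zetaInv p η B (a, b) = sgn (p a + p b) • form p η (B (e b)) (e a) := by
  have h := form_mem hη (hB.isHomog p b) (isHomog_e p a)
  rw [add_comm] at h
  rw [zetaInv_apply, tw_of_mem _ h, ZMod2.mul_self]

theorem zetaInv_isHomog (hη : IsOrthosymplectic p η) {B : EndV I} (hB : IsEven p B) :
    IsHomog (parP p) 0 (zetaInv p η B) := by
  rintro ⟨a, b⟩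
  rw [zetaInv_eq hη hB, zero_add]
  refine Submodule.smul_mem _ _ ?_
  have h := form_mem hη (hB.isHomog p b) (isHomog_e p a)
  rwa [add_comm] at h

/-- The coordinates of ω(A) are signed Gram entries, since (e_a, A†A e_b) = (A e_a, A e_b); the
signs come from `dualCoord` and from exchanging the arguments of the form. -/
theorem zetaInv_omega (hη : IsOrthosymplectic p η) {A : EndV I} (hA : IsEven p A) (a b : I) :
    zetaInv p η (omega p η A) (a, b)
      = sgn (p a + p b + p a * p b) • form p η (A (e a)) (A (e b)) := by
  rw [zetaInv_eq hη (hA.omega hη), form_symm hη ((hA.omega hη).isHomog p b) (isHomog_e p a),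
    omega, Module.End.mul_apply, form_dagger hη hA, smul_smul, ← sgn_add, mul_comm (p b)]

/-! ### The bracket -/

theorem sum_Ioi_pos_false {d : ℕ} {M : Type*} [AddCommMonoid M] (f : Fin (2 * d) → M) (k : Fin d) :
    ∑ l ∈ Finset.Ioi (pos k false), f l
      = f (pos k true) + ∑ l ∈ Finset.Ioi k, (f (pos l false) + f (pos l true)) := by
  have h : f (pos k true) = ∑ l, if l = k then f (pos k true) else 0 := by simp
  rw [h, sum_Ioi_eq, sum_Ioi_eq, sum_blocks, ← Finset.sum_add_distrib]
  refine Finset.sum_congr rfl fun l _ => ?_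
  by_cases hl : l = k
  · subst hl
    simp [Fin.lt_def, pos_val]
  · have hl' : k ≠ l := fun h => hl h.symm
    simp only [pos_lt_pos hl', if_neg hl, zero_add]
    split_ifs <;> simp

theorem sum_Ioi_pos_true {d : ℕ} {M : Type*} [AddCommMonoid M] (f : Fin (2 * d) → M) (k : Fin d) :
    ∑ l ∈ Finset.Ioi (pos k true), f l
      = ∑ l ∈ Finset.Ioi k, (f (pos l false) + f (pos l true)) := by
  rw [sum_Ioi_eq, sum_Ioi_eq, sum_blocks]
  refine Finset.sum_congr rfl fun l _ => ?_
  by_cases hl : l = k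
  · subst hl
    simp [Fin.lt_def, pos_val]
  · have hl' : k ≠ l := fun h => hl h.symm
    simp only [pos_lt_pos hl']
    split_ifs <;> simp

theorem bracket_apply {d : ℕ} (x : Tens (2 * d) I) :
    bracket η d x = ∑ i : Fin (2 * d) → I,
      (∏ k : Fin d, η (i (pos k false)) (i (pos k true))) • x i := rfl

/-- Where η does not vanish, all later blocks are even. The only surviving twist is that of a first
factor past its partner, which is the twist in the form. -/
theorem bracket_tprod (hη : IsOrthosymplectic p η) {d : ℕ} (v : Fin (2 * d) → Mod I) :
    bracket η d (tprod p v) = oprod fun k => form p η (v (pos k false)) (v (pos k true)) := by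
  have h : ∀ k : Fin d, form p η (v (pos k false)) (v (pos k true)) = ∑ ab : I × I,
      η ab.1 ab.2 • (tw (p ab.1) (v (pos k false) ab.1) * v (pos k true) ab.2) := fun k => by
    rw [form_eq, Fintype.sum_prod_type]
  simp only [h, oprod_sum]
  rw [bracket_apply, ← Equiv.sum_comp blocks]
  refine Finset.sum_congr rfl fun i _ => ?_
  rw [oprod_smul]
  simp only [blocks_apply]
  by_cases h2 : ∀ k, p (i (pos k false)) = p (i (pos k true))
  · congr 1
    rw [tprod_apply, oprod_blocks]
    simp only [sum_Ioi_pos_false, sum_Ioi_pos_true, h2, ZMod2.add_self, Finset.sum_const_zero,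
      add_zero, tw_zero]
  · push Not at h2
    obtain ⟨k, hk⟩ := h2
    have h3 : ∏ k, η (i (pos k false)) (i (pos k true)) = 0 :=
      Finset.prod_eq_zero (Finset.mem_univ k) (hη.even _ _ hk)
    rw [h3, zero_smul, zero_smul]

/-! ### The pairing -/

/-- `y ↦ x ⊗ y`. -/
def tmulL {J K : Type*} (q : K → ZMod 2) (x : Mod J) : Mod K →ₗ[Grᵐᵒᵖ] Mod (J × K) where
  toFun y := tmul q x y
  map_add' y z := by ext; simp [tmul, mul_add]
  map_smul' c y := by ext; simp [tmul, mul_assoc]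

theorem tmulL_apply {J K : Type*} (q : K → ZMod 2) (x : Mod J) (y : Mod K) :
    tmulL q x y = tmul q x y := rfl

theorem pairing_tmul {r : ℕ} (x y : Tens r I) :
    pairing p r (tmul (parT p) x y) = ∑ i : Fin r → I,
      sgn (∑ a, ∑ b ∈ Finset.Ioi a, p (i a) * p (i b)) • (tw (parT p i) (x i) * y i) := rfl

theorem pairing_tmul_e {r : ℕ} (x : Tens r I) (m : Fin r → I) :
    pairing p r (tmul (parT p) x (e m))
      = sgn (∑ a, ∑ b ∈ Finset.Ioi a, p (m a) * p (m b)) • tw (parT p m) (x m) := by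
  rw [pairing_tmul, Finset.sum_eq_single m]
  · simp [e]
  · intro i _ hi
    simp [e, hi]
  · simp

/-- Both sides are linear in `x`; at a basis vector each is the product of the Gram entries `(A e, A
e)` over the blocks. -/
theorem pairing_tensPow_omega (hη : IsOrthosymplectic p η) {A : EndV I} (hA : IsEven p A) {d : ℕ}
    (x : Tens (2 * d) I) :
    pairing p (2 * d) (tmul (parT p) (tensPow p d (zetaInv p η (omega p η A))) x)
      = bracket η d (tpow p A x) := by
  suffices h : (pairing p (2 * d)).comp
      (tmulL (parT p) (tensPow p d (zetaInv p η (omega p η A)))) = (bracket η d).comp (tpow p A) from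
    LinearMap.congr_fun h x
  refine linearMap_ext_e fun m => ?_
  rw [LinearMap.comp_apply, LinearMap.comp_apply, tmulL_apply, pairing_tmul_e, tpow_e,
    bracket_tprod hη, tensPow_eq, tensProd,
    tprod_of_mem (parP p) fun k => zetaInv_isHomog hη (hA.omega hη) (blocks m k)]
  simp only [blocks_apply, zetaInv_omega hη hA, oprod_smul, ← sgn_sum]
  have h := oprod_mem fun k : Fin d =>
    form_mem hη (hA.isHomog p (m (pos k false))) (hA.isHomog p (m (pos k true)))
  rw [map_smul, map_smul, tw_of_mem _ h, smul_smul, smul_smul, smul_smul, ← sgn_add, ← sgn_add,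
    ← sgn_add]
  have h1 : parT p m = ∑ k : Fin d, (p (m (pos k false)) + p (m (pos k true))) := sum_blocks _
  rw [h1, ZMod2.mul_self, sum_pairs_blocks]
  -- The sign is trivial because each contribution occurs twice: products inside blocks (pairing,
  -- ω), block parities (moving past `e m`, ω), products between blocks (pairing, tensor
  -- coordinates).
  convert one_smul ℂ _
  convert sgn_zero
  have h2 : ∀ k l : Fin d, parP p (m (pos l false), m (pos l true))
      * (0 + parP p (m (pos k false), m (pos k true)))
      = p (m (pos k false)) * p (m (pos l false)) + p (m (pos k false)) * p (m (pos l true)) +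
        (p (m (pos k true)) * p (m (pos l false)) + p (m (pos k true)) * p (m (pos l true))) := by
    intro k l
    simp only [parP]
    ring
  simp only [h2]
  have h3 : ∀ x y z : ZMod 2, x + y + y + (z + x) + z = 0 := by decide
  conv_lhs =>
    enter [1, 2]
    rw [Finset.sum_add_distrib]
  exact h3 _ _ _

end Space

section Space

variable {I : Type*} [Fintype I] [DecidableEq I] {p : I → ZMod 2} {η : Matrix I I ℂ}

/-! ### Invariance under the groups -/

theorem sum_pairs_symm {r : ℕ} {M : Type*} [AddCommMonoid M] (g : Fin r → Fin r → M) :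
    ∑ a, ∑ b ∈ Finset.Ioi a, g a b = ∑ b, ∑ a ∈ Finset.Iio b, g a b := by
  simp only [sum_Ioi_eq, sum_Iio_eq]
  exact Finset.sum_comm

/-- The φ's need not be homogeneous, so twists replace their signs. The result depends only on the
values `φ k (v k)` and the parities of the `v k`, which makes GL-invariance immediate. -/
theorem pairing_tprod {r : ℕ} (φ : Fin r → Dual I) {v : Fin r → Mod I} {ν : Fin r → ZMod 2}
    (hv : ∀ k, IsHomog p (ν k) (v k)) :
    pairing p r (tmul (parT p) (tprod p fun k => dualCoord p (φ k)) (tprod p v))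
      = sgn (∑ k, ∑ l ∈ Finset.Iio k, ν l * ν k) •
        oprod fun k => tw (∑ l ∈ Finset.Iio k, ν l) (φ k (v k)) := by
  simp only [linearMap_apply_eq (φ _) (v _), map_sum, oprod_sum]
  rw [pairing_tmul, Finset.smul_sum]
  refine Finset.sum_congr rfl fun i _ => ?_
  simp only [map_mul]
  rw [oprod_mul' fun k => tw_mem (hv k (i k)), oprod_tw fun k => hv k (i k),
    tprod_of_mem p fun k => hv k (i k), tprod_apply, map_oprod]
  simp only [dualCoord, tw_tw, mul_smul_comm, smul_smul, ← sgn_add]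
  have h1 : ∀ k, parT p i + (∑ l ∈ Finset.Ioi k, p (i l) + p (i k))
      = ∑ l ∈ Finset.Iio k, (ν l + p (i l)) + ∑ l ∈ Finset.Iio k, ν l := by
    intro k
    rw [parT, ← sum_Iio_add_Ioi _ k, Finset.sum_add_distrib]
    linear_combination ZMod2.add_self (∑ l ∈ Finset.Ioi k, p (i l)) + ZMod2.add_self (p (i k))
      - ZMod2.add_self (∑ l ∈ Finset.Iio k, ν l)
  simp only [h1]
  congr 2
  simp only [sum_pairs_symm, Finset.sum_mul, ← Finset.sum_add_distrib]
  refine Finset.sum_congr rfl fun k _ => Finset.sum_congr rfl fun l _ => ?_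
  generalize p (i k) = x, p (i l) = y, ν k = z, ν l = w
  revert x y z w; decide

theorem pairing_tpow (g : (EndV I)ˣ) (hg : g ∈ GLV p) {r : ℕ} (φ : Fin r → Dual I) (x : Tens r I) :
    pairing p r (tmul (parT p)
        (tprod p fun k => dualCoord p ((φ k).comp ((g⁻¹ : (EndV I)ˣ) : EndV I)))
        (tpow p (g : EndV I) x))
      = pairing p r (tmul (parT p) (tprod p fun k => dualCoord p (φ k)) x) := by
  suffices h : ((pairing p r).comp (tmulL (parT p)
      (tprod p fun k => dualCoord p ((φ k).comp ((g⁻¹ : (EndV I)ˣ) : EndV I))))).comp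
        (tpow p (g : EndV I))
      = (pairing p r).comp (tmulL (parT p) (tprod p fun k => dualCoord p (φ k))) from
    LinearMap.congr_fun h x
  refine linearMap_ext_e fun m => ?_
  simp only [LinearMap.comp_apply, tmulL_apply, tpow_e]
  rw [← tprod_e p m, pairing_tprod _ fun k => IsEven.isHomog p hg (m k),
    pairing_tprod _ fun k => isHomog_e p (m k)]
  have h : ∀ y, ((g⁻¹ : (EndV I)ˣ) : EndV I) ((g : EndV I) y) = y := fun y => by
    rw [← Module.End.mul_apply, Units.inv_mul, Module.End.one_apply]
  simp only [LinearMap.comp_apply, h]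

theorem varpiRight_tmul {r : ℕ} (π : Equiv.Perm (Fin r)) (x y : Tens r I) :
    varpiRight p π (tmul (parT p) x y) = tmul (parT p) x (varpi p π y) := by
  ext ⟨i, j⟩
  have h : parT p (j ∘ π) = parT p j := Equiv.sum_comp π fun k => p (j k)
  change sgn _ • (tw (parT p (j ∘ π)) (x i) * y (j ∘ π)) = tw (parT p j) (x i) * (sgn _ • y (j ∘ π))
  rw [h, mul_smul_comm]

theorem varpiLeft_tmul {r : ℕ} (π : Equiv.Perm (Fin r)) (x y : Tens r I) :
    varpiLeft p π (tmul (parT p) x y) = tmul (parT p) (varpi p π x) y := by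
  ext ⟨i, j⟩
  change sgn _ • (tw (parT p j) (x (i ∘ π)) * y j) = tw (parT p j) (sgn _ • x (i ∘ π)) * y j
  rw [map_smul, smul_mul_assoc]

theorem deltaPerm_tmul {r : ℕ} (π : Equiv.Perm (Fin r)) (x y : Tens r I) :
    deltaPerm p π (tmul (parT p) x y) = pairing p r (tmul (parT p) x (varpi p π y)) := by
  rw [deltaPerm, LinearMap.comp_apply, varpiRight_tmul]

theorem deltaPerm_mem_invGL {r : ℕ} (π : Equiv.Perm (Fin r)) : deltaPerm p π ∈ invGL p r := by
  intro g hg φ v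
  rw [deltaPerm_tmul, deltaPerm_tmul, ← tpow_tprod p hg, varpi_tpow p π hg, pairing_tpow g hg]

theorem bracket_tpow (hη : IsOrthosymplectic p η) {g : (EndV I)ˣ} (hg : g ∈ OSpV p η) {d : ℕ}
    (x : Tens (2 * d) I) : bracket η d (tpow p (g : EndV I) x) = bracket η d x := by
  suffices h : (bracket η d).comp (tpow p (g : EndV I)) = bracket η d from
    LinearMap.congr_fun h x
  refine linearMap_ext_e fun m => ?_
  rw [LinearMap.comp_apply, tpow_e, bracket_tprod hη, ← tprod_e p m, bracket_tprod hη]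
  simp only [hg.2]

theorem kappaPerm_mem_invOSp (hη : IsOrthosymplectic p η) {d : ℕ}
    (π : Equiv.Perm (Fin (2 * d))) : kappaPerm p η π ∈ invOSp p η (2 * d) := by
  intro g hg v
  rw [kappaPerm, LinearMap.comp_apply, LinearMap.comp_apply, ← tpow_tprod p hg.1,
    varpi_tpow p π hg.1, bracket_tpow hη hg]

theorem kappaPerm_mul (hη : IsOrthosymplectic p η) {d : ℕ} {σ : Equiv.Perm (Fin (2 * d))}
    (hσ : σ ∈ centr d) (π : Equiv.Perm (Fin (2 * d))) :
    kappaPerm p η (σ * π) = kappaPerm p η π := by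
  refine LinearMap.ext fun x => ?_
  rw [kappaPerm, kappaPerm, LinearMap.comp_apply, LinearMap.comp_apply, varpi_mul,
    bracket_varpi hη hσ]

/-- Permuting both tensors gives the same sign twice, and the reordering sign of the pairing is a
sum over unordered pairs. -/
theorem pairing_varpi {r : ℕ} (π : Equiv.Perm (Fin r)) (z : TT r I) :
    pairing p r (varpiLeft p π (varpiRight p π z)) = pairing p r z := by
  change ∑ i : Fin r → I, sgn (∑ a, ∑ b ∈ Finset.Ioi a, p (i a) * p (i b))
    • sgn (inv π (p ∘ i ∘ π)) • sgn (inv π (p ∘ i ∘ π)) • z (i ∘ π, i ∘ π) = _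
  have h : ∀ i : Fin r → I, ∑ a, ∑ b ∈ Finset.Ioi a, p (i a) * p (i b)
      = ∑ a, ∑ b ∈ Finset.Ioi a, p ((i ∘ π) a) * p ((i ∘ π) b) := fun i =>
    (sum_pairs_comp π (fun a b => p (i a) * p (i b)) fun a b => mul_comm _ _).symm
  refine (Finset.sum_congr rfl fun i _ => ?_).trans
    (Equiv.sum_comp (Equiv.arrowCongr π.symm (Equiv.refl I))
      fun i => sgn (∑ a, ∑ b ∈ Finset.Ioi a, p (i a) * p (i b)) • z (i, i))
  rw [smul_smul (sgn (inv _ _)), sgn_mul_self, one_smul, h]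
  rfl

theorem varpiLeft_varpiRight {r : ℕ} (π σ : Equiv.Perm (Fin r)) (z : TT r I) :
    varpiLeft p π (varpiRight p σ z) = varpiRight p σ (varpiLeft p π z) := by
  ext ⟨i, j⟩
  change sgn _ • sgn _ • z _ = sgn _ • sgn _ • z _
  rw [smul_comm]

theorem varpiRight_mul {r : ℕ} (π σ : Equiv.Perm (Fin r)) (z : TT r I) :
    varpiRight p (π * σ) z = varpiRight p π (varpiRight p σ z) := by
  ext ⟨i, j⟩
  exact congrFun (varpi_mul p π σ fun j => z (i, j)) j

/-- Permuting the dual factors by σ is undone by left multiplication of the index by σ. Hence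
averaging over C on the left yields a C-invariant functional. -/
theorem deltaPerm_varpiLeft {r : ℕ} (π σ : Equiv.Perm (Fin r)) (z : TT r I) :
    deltaPerm p (σ * π) (varpiLeft p σ z) = deltaPerm p π z := by
  rw [deltaPerm, deltaPerm, LinearMap.comp_apply, LinearMap.comp_apply, varpiRight_mul,
    ← varpiLeft_varpiRight, ← varpiLeft_varpiRight, pairing_varpi]

end Space

/-! ### The symmetriser -/

theorem comp_eq_comp_iff {d : ℕ} {π π' : Equiv.Perm (Fin (2 * d))}
    (h : (D0 d).comp π = (D0 d).comp π') : π * π'⁻¹ ∈ centr d := by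
  have h1 : π⁻¹ * pairInvolution d * π = π'⁻¹ * pairInvolution d * π' :=
    congrArg Diagram.partner h
  rw [mem_centr_iff]
  have h2 : π * (π⁻¹ * pairInvolution d * π) * π'⁻¹
      = π * (π'⁻¹ * pairInvolution d * π') * π'⁻¹ := by rw [h1]
  simp only [mul_assoc, mul_inv_cancel_left, mul_inv_cancel, mul_one] at h2
  rw [mul_assoc, ← h2]

theorem symmetriser_mul_single {d : ℕ} {σ : Equiv.Perm (Fin (2 * d))} (hσ : σ ∈ centr d)
    (π : Equiv.Perm (Fin (2 * d))) :
    symmetriser d * MonoidAlgebra.single (σ * π) 1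
      = symmetriser d * MonoidAlgebra.single π 1 := by
  classical
  simp only [symmetriser, smul_mul_assoc, Finset.sum_mul, MonoidAlgebra.single_mul_single]
  congr 1
  rw [← Equiv.sum_comp (Equiv.mulRight (⟨σ, hσ⟩ : centr d))
    fun τ => MonoidAlgebra.single ((τ : Equiv.Perm (Fin (2 * d))) * π) ((1 : Gr) * 1)]
  simp [mul_assoc]

section Space

variable {I : Type*} [Fintype I] [DecidableEq I] {p : I → ZMod 2} {η : Matrix I I ℂ}

open Classical in
theorem delta_symmetriser {d : ℕ} (π : Equiv.Perm (Fin (2 * d))) :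
    delta (I := I) p (symmetriser d * MonoidAlgebra.single π 1)
      = (Nat.card (centr d) : ℂ)⁻¹ • ∑ σ : centr d, deltaPerm p ((σ : Equiv.Perm _) * π) := by
  have h : ∀ (ρ : Equiv.Perm (Fin (2 * d))),
      delta (I := I) p (MonoidAlgebra.single ρ 1) = deltaPerm p ρ := by
    intro ρ
    change ∑ π, (MonoidAlgebra.single ρ (1 : Gr)).coeff π • deltaPerm p π = _
    simp [Finsupp.single_apply]
  simp only [symmetriser, smul_mul_assoc, Finset.sum_mul, MonoidAlgebra.single_mul_single, one_mul]
  rw [LinearMap.map_smul_of_tower, map_sum]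
  congr 1
  refine Finset.sum_congr ?_ fun σ _ => h _
  ext; simp

end Space
/-! ### Polarisation -/

/-- Expand the product over all `k` of (-1 + [k ∉ R]), which has a zero factor unless `R` is
everything. -/
theorem sum_neg_one_pow_of_subset {ι : Type*} [Fintype ι] [DecidableEq ι] (R : Finset ι) :
    ∑ S : Finset ι, (if R ⊆ S then (-1 : ℂ) ^ S.card else 0)
      = if R = Finset.univ then (-1) ^ Fintype.card ι else 0 := by
  have h := Finset.prod_add (fun _ : ι => (-1 : ℂ)) (fun k => if k ∈ R then 0 else 1) Finset.univ
  rw [Finset.powerset_univ] at h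
  have h1 : ∀ S : Finset ι, (if R ⊆ S then (-1 : ℂ) ^ S.card else 0)
      = (∏ _k ∈ S, (-1 : ℂ)) * ∏ k ∈ Finset.univ \ S, if k ∈ R then 0 else 1 := by
    intro S
    rw [Finset.prod_const]
    split_ifs with hRS
    · rw [Finset.prod_eq_one, mul_one]
      intro k hk
      rw [if_neg]
      exact fun hkR => (Finset.mem_sdiff.1 hk).2 (hRS hkR)
    · obtain ⟨k, hkR, hkS⟩ := Finset.not_subset.1 hRS
      rw [Finset.prod_eq_zero (i := k) (by simp [hkS]) (by simp [hkR]), mul_zero]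
  rw [Finset.sum_congr rfl fun S _ => h1 S, ← h]
  split_ifs with hR
  · subst hR
    simp
  · have : ∃ k, k ∉ R := by
      by_contra! h
      exact hR (Finset.eq_univ_iff_forall.2 h)
    obtain ⟨k, hk⟩ := this
    exact Finset.prod_eq_zero (Finset.mem_univ k) (by simp [hk])

/-- A map that attains every `some k` has an injective, hence bijective, section, so it never takes
the value `none`. -/
theorem sum_surjective_option {ι N : Type*} [Fintype ι] [DecidableEq ι] [AddCommMonoid N]
    (f : (ι → Option ι) → N) :
    ∑ r with ∀ k, ∃ i, r i = some k, f r = ∑ τ : Equiv.Perm ι, f fun k => some (τ k) := by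
  symm
  refine Finset.sum_bij (fun τ _ k => some (τ k)) ?_ ?_ ?_ fun _ _ => rfl
  · intro τ _
    simp only [Finset.mem_filter, Finset.mem_univ, true_and]
    exact fun k => ⟨τ.symm k, by simp⟩
  · intro τ _ τ' _ h
    ext k
    simpa using congrFun h k
  · intro r hr
    simp only [Finset.mem_filter, Finset.mem_univ, true_and] at hr
    choose g hg using hr
    have hinj : Function.Injective g := fun k l hkl =>
      Option.some_injective _ (by rw [← hg, ← hg, hkl])
    let e := Equiv.ofBijective g (Finite.injective_iff_bijective.1 hinj)
    refine ⟨e.symm, Finset.mem_univ _, ?_⟩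
    ext1 i
    rw [← hg]
    congr 1
    exact e.apply_symm_apply i

/-- The polarisation formula, with an arbitrary base point. -/
theorem polarisation {ι V N : Type*} [Fintype ι] [DecidableEq ι] [AddCommGroup V] [Module ℂ V]
    [AddCommGroup N] [Module ℂ N] (M : MultilinearMap ℂ (fun _ : ι => V) N) (c : V) (T : ι → V) :
    ∑ S : Finset ι, (-1 : ℂ) ^ S.card • M (fun _ => c + ∑ k ∈ S, T k)
      = (-1 : ℂ) ^ Fintype.card ι • ∑ τ : Equiv.Perm ι, M (T ∘ τ) := by
  -- The label `none` stands for the base point. After expansion, the signed sum over `S` keeps only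
  -- the label functions attaining every `some k`, which leave no slot for `none`.
  let t : Option ι → V := fun o => o.elim c T
  have h1 : ∀ S : Finset ι, M (fun _ => c + ∑ k ∈ S, T k)
      = ∑ r : ι → Option ι, if (∀ i, ∀ k, r i = some k → k ∈ S) then M (fun i => t (r i)) else 0 := by
    intro S
    have h2 : c + ∑ k ∈ S, T k = ∑ o ∈ Finset.insertNone S, t o := by
      rw [Finset.sum_insertNone]; rfl
    rw [h2, M.map_sum_finset (fun _ o => t o) fun _ => Finset.insertNone S, ← Finset.sum_filter]
    refine Finset.sum_congr ?_ fun _ _ => rfl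
    ext r
    simp [Fintype.mem_piFinset, Finset.mem_insertNone]
  simp only [h1, Finset.smul_sum]
  rw [Finset.sum_comm]
  have h3 : ∀ r : ι → Option ι, ∑ S : Finset ι, (-1 : ℂ) ^ S.card •
      (if (∀ i, ∀ k, r i = some k → k ∈ S) then M (fun i => t (r i)) else 0)
      = if ∀ k, ∃ i, r i = some k then (-1 : ℂ) ^ Fintype.card ι • M (fun i => t (r i)) else 0 := by
    intro r
    have h4 := sum_neg_one_pow_of_subset (Finset.univ.filter fun k => ∃ i, r i = some k)
    have h5 : ∀ S : Finset ι, (Finset.univ.filter fun k => ∃ i, r i = some k) ⊆ S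
        ↔ ∀ i, ∀ k, r i = some k → k ∈ S := by
      intro S
      simp only [Finset.subset_iff, Finset.mem_filter, Finset.mem_univ, true_and]
      exact ⟨fun h i k hik => h ⟨i, hik⟩, fun h k ⟨i, hik⟩ => h i k hik⟩
    have h6 : (Finset.univ.filter fun k => ∃ i, r i = some k) = Finset.univ
        ↔ ∀ k, ∃ i, r i = some k := by
      simp [Finset.filter_eq_self]
    simp only [h5, h6] at h4
    have h7 := congrArg (fun z : ℂ => z • M (fun i => t (r i))) h4
    simp only [Finset.sum_smul, ite_smul, zero_smul] at h7
    rw [← h7]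
    refine Finset.sum_congr rfl fun S _ => ?_
    split_ifs <;> simp
  rw [Finset.sum_congr rfl fun r _ => h3 r, ← Finset.sum_filter, sum_surjective_option]
  rfl

/-! ### Square roots of unipotent elements -/

/-- The square root is improved one coefficient at a time; constant term 1 makes the linear equation
for the next coefficient solvable. -/
theorem exists_polynomial_sqrt (n : ℕ) :
    ∃ P : Polynomial ℂ, Polynomial.X ^ n ∣ P ^ 2 - (1 + Polynomial.X) := by
  suffices h : ∃ P : Polynomial ℂ, P.coeff 0 = 1 ∧
      Polynomial.X ^ (n + 1) ∣ P ^ 2 - (1 + Polynomial.X) by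
    obtain ⟨P, _, hP⟩ := h
    exact ⟨P, (pow_dvd_pow _ n.le_succ).trans hP⟩
  induction n with
  | zero => exact ⟨1, by simp, -1, by ring⟩
  | succ n ih =>
    obtain ⟨P, hP, R, hR⟩ := ih
    -- With c the new coefficient, the next error has constant term R(0) + 2c, which vanishes for c
    -- = -R(0)/2.
    refine ⟨P + Polynomial.C (-(R.coeff 0) / 2) * Polynomial.X ^ (n + 1), ?_, ?_⟩
    · simp [hP]
    · have h : Polynomial.X ∣ R + 2 * Polynomial.C (-(R.coeff 0) / 2) * P
          + Polynomial.C (-(R.coeff 0) / 2) ^ 2 * Polynomial.X ^ (n + 1) := by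
        rw [Polynomial.X_dvd_iff]
        simp [hP, Polynomial.mul_coeff_zero]
        ring
      obtain ⟨Q, hQ⟩ := h
      refine ⟨Q, ?_⟩
      rw [pow_succ _ (n + 1), mul_assoc, ← hQ]
      linear_combination hR

/-- The root is a polynomial in `x`, so it will inherit evenness and self-adjointness. -/
theorem exists_aeval_sq_eq {R : Type*} [Ring R] [Algebra ℂ R] {x : R} (hx : IsNilpotent x) :
    ∃ P : Polynomial ℂ, Polynomial.aeval x P * Polynomial.aeval x P = 1 + x := by
  obtain ⟨n, hn⟩ := hx
  obtain ⟨P, Q, hQ⟩ := exists_polynomial_sqrt n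
  refine ⟨P, ?_⟩
  have h := congrArg (Polynomial.aeval x) hQ
  simp only [map_sub, map_mul, map_pow, map_add, map_one, Polynomial.aeval_X, hn, zero_mul] at h
  rw [← pow_two]
  exact sub_eq_zero.1 h

/-- Modulo the ideal generated by the central `s`, powers of `x + s * z` are powers of `x`; an
element of that ideal has square zero. No commutation of `x` and `z` is needed. -/
theorem isNilpotent_add_central_mul {R : Type*} [Ring R] {x s : R} (hx : IsNilpotent x)
    (hs : ∀ y, s * y = y * s) (hss : s * s = 0) (z : R) : IsNilpotent (x + s * z) := by
  have h : ∀ n : ℕ, ∃ y, (x + s * z) ^ n = x ^ n + s * y := by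
    intro n
    induction n with
    | zero => exact ⟨0, by simp⟩
    | succ n ih =>
      obtain ⟨y, hy⟩ := ih
      refine ⟨y * x + x ^ n * z + y * s * z, ?_⟩
      rw [pow_succ, hy, pow_succ]
      have h1 : x ^ n * (s * z) = s * (x ^ n * z) := by rw [← mul_assoc, ← hs, mul_assoc]
      rw [add_mul, mul_add, mul_add, h1]
      noncomm_ring
  obtain ⟨n, hn⟩ := hx
  obtain ⟨y, hy⟩ := h n
  refine ⟨n * 2, ?_⟩
  rw [pow_mul, hy, hn, zero_add, pow_two, mul_assoc, ← mul_assoc y, ← hs, ← mul_assoc, ← mul_assoc,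
    hss, zero_mul, zero_mul]

theorem isNilpotent_sum_central_mul {R ι : Type*} [Ring R] [DecidableEq ι] (s z : ι → R)
    (hs : ∀ i y, s i * y = y * s i) (hss : ∀ i, s i * s i = 0) (S : Finset ι) :
    IsNilpotent (∑ i ∈ S, s i * z i) := by
  induction S using Finset.induction_on with
  | empty => simp
  | insert i S hi ih =>
    rw [Finset.sum_insert hi, add_comm]
    exact isNilpotent_add_central_mul ih (hs i) (hss i) (z i)

section Space

variable {I : Type*} [Fintype I] [DecidableEq I] {p : I → ZMod 2} {η : Matrix I I ℂ}

/-! ### Self-adjoint endomorphisms -/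

/-- The even endomorphisms that are self-adjoint. -/
def IsSelfAdj (p : I → ZMod 2) (η : Matrix I I ℂ) (A : EndV I) : Prop :=
  IsEven p A ∧ ∀ v w, form p η (A v) w = form p η v (A w)

theorem form_add_left (v v' w : Mod I) : form p η (v + v') w = form p η v w + form p η v' w := by
  simp [form_eq, add_mul, Finset.sum_add_distrib]

theorem form_add_right (v w w' : Mod I) : form p η v (w + w') = form p η v w + form p η v w' :=
  map_add _ _ _

theorem form_smul_left (c : ℂ) (v w : Mod I) : form p η (c • v) w = c • form p η v w := by
  simp only [form_eq, Finset.smul_sum, Pi.smul_apply, map_smul, smul_mul_assoc]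
  refine Finset.sum_congr rfl fun a _ => Finset.sum_congr rfl fun b _ => smul_comm _ _ _

theorem form_smul_right (c : ℂ) (v w : Mod I) : form p η v (c • w) = c • form p η v w :=
  LinearMap.map_smul_of_tower (lower p η v) c w

theorem IsSelfAdj.aeval {B : EndV I} (hB : IsSelfAdj p η B) (P : Polynomial ℂ) :
    IsSelfAdj p η (Polynomial.aeval B P) := by
  have hpow : ∀ n : ℕ, IsSelfAdj p η (B ^ n) := by
    intro n
    induction n with
    | zero => exact ⟨isEven_one, fun v w => rfl⟩
    | succ n ih =>
      refine ⟨by rw [pow_succ]; exact ih.1.mul hB.1, fun v w => ?_⟩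
      conv_lhs => rw [pow_succ, Module.End.mul_apply, ih.2, hB.2]
      rw [pow_succ', Module.End.mul_apply]
  induction P using Polynomial.induction_on' with
  | add P Q hP hQ =>
    rw [map_add]
    refine ⟨fun a b => Submodule.add_mem _ (hP.1 a b) (hQ.1 a b), fun v w => ?_⟩
    rw [LinearMap.add_apply, LinearMap.add_apply, form_add_left, form_add_right, hP.2, hQ.2]
  | monomial n c =>
    rw [Polynomial.aeval_monomial, ← Algebra.smul_def]
    refine ⟨fun a b => Submodule.smul_mem _ _ ((hpow n).1 a b), fun v w => ?_⟩
    rw [LinearMap.smul_apply, LinearMap.smul_apply, form_smul_left, form_smul_right, (hpow n).2]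

theorem IsSelfAdj.omega_eq (hη : IsOrthosymplectic p η) {A : EndV I} (hA : IsSelfAdj p η A) :
    omega p η A = A * A := by
  have h : dagger p η A = A := by
    refine LinearMap.ext fun w => ?_
    ext a
    simp only [dagger_apply, hA.2, form_e_left, Finset.smul_sum, smul_smul]
    rw [Finset.sum_comm]
    simp only [← Finset.sum_smul]
    have h : ∀ c, ∑ b, η⁻¹ a b * η b c = (1 : Matrix I I ℂ) a c := fun c => by
      rw [← Matrix.nonsing_inv_mul _ hη.nondegenerate, Matrix.mul_apply]
    simp only [h, Matrix.one_apply]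
    simp
  rw [omega, h]

/-! ### Flip-invariant tensors as self-adjoint endomorphisms -/

/-- The endomorphism that `zetaInv` sends to `t`. -/
def zeta (p : I → ZMod 2) (η : Matrix I I ℂ) (t : Mod (I × I)) : EndV I where
  toFun x := fun c => ∑ b, (∑ a, (η⁻¹ c a * sgn (p a + p b + p a * p b)) • t (a, b)) * x b
  map_add' x y := by ext c; simp [mul_add, Finset.sum_add_distrib]
  map_smul' r x := by ext c; simp [Finset.sum_mul, mul_assoc]

theorem zeta_e (t : Mod (I × I)) (b c : I) :
    zeta p η t (e b) c = ∑ a, (η⁻¹ c a * sgn (p a + p b + p a * p b)) • t (a, b) := by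
  change ∑ b', _ * (e b : Mod I) b' = _
  simp [e, Pi.single_apply]

theorem zeta_isEven (hη : IsOrthosymplectic p η) {t : Mod (I × I)} (ht : IsHomog (parP p) 0 t) :
    IsEven p (zeta p η t) := by
  intro c b
  rw [zeta_e]
  refine Submodule.sum_mem _ fun a _ => ?_
  by_cases hca : p c = p a
  · have := ht (a, b)
    rw [zero_add] at this
    rw [hca]
    exact Submodule.smul_mem _ _ this
  · rw [hη.inv_even hca]
    simp

theorem form_e_zeta (hη : IsOrthosymplectic p η) (t : Mod (I × I)) (a b : I) :
    form p η (e a) (zeta p η t (e b)) = sgn (p a + p b + p a * p b) • t (a, b) := by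
  rw [form_e_left]
  simp only [zeta_e, Finset.smul_sum, smul_smul, ← mul_assoc]
  rw [Finset.sum_comm]
  simp only [← Finset.sum_smul, ← Finset.sum_mul]
  have h : ∀ c, ∑ b, η a b * η⁻¹ b c = (1 : Matrix I I ℂ) a c := fun c => by
    rw [← hη.mul_inv, Matrix.mul_apply]
  simp only [h, Matrix.one_apply]
  simp

theorem form_zeta_e (hη : IsOrthosymplectic p η) {t : Mod (I × I)} (ht : IsHomog (parP p) 0 t)
    (a b : I) : form p η (zeta p η t (e b)) (e a) = sgn (p a + p b) • t (a, b) := by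
  rw [form_symm hη ((zeta_isEven hη ht).isHomog p b) (isHomog_e p a), form_e_zeta hη, smul_smul,
    ← sgn_add]
  congr 2
  generalize p a = x, p b = y
  clear ht
  revert x y; decide

theorem zetaInv_zeta (hη : IsOrthosymplectic p η) {t : Mod (I × I)} (ht : IsHomog (parP p) 0 t) :
    zetaInv p η (zeta p η t) = t := by
  ext ⟨a, b⟩
  rw [zetaInv_eq hη (zeta_isEven hη ht), form_zeta_e hη ht, smul_smul, sgn_mul_self, one_smul]

/-- On basis vectors the two sides are `t (b, a)` and `t (a, b)` up to sign, and flip-invariance is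
exactly the relation between them. -/
theorem zeta_isSelfAdj (hη : IsOrthosymplectic p η) {t : Mod (I × I)} (ht : IsHomog (parP p) 0 t)
    (hf : flip p t = t) : IsSelfAdj p η (zeta p η t) := by
  refine ⟨zeta_isEven hη ht, fun v w => ?_⟩
  rw [form_map_left (zeta_isEven hη ht), form_left v]
  refine Finset.sum_congr rfl fun a _ => ?_
  congr 1
  suffices h : lower p η (zeta p η t (e a)) = (lower p η (e a)).comp (zeta p η t) from
    LinearMap.congr_fun h w
  refine linearMap_ext_e fun b => ?_
  have h1 := form_zeta_e hη ht b a
  have h2 := form_e_zeta hη t a b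
  have h3 : t (a, b) = sgn (p a * p b) • t (b, a) := (congrFun hf (a, b)).symm
  rw [h3, smul_smul, ← sgn_add] at h2
  refine h1.trans (Eq.trans ?_ h2.symm)
  congr 2
  generalize p a = x, p b = y
  clear h1 h2 h3 ht hf
  revert x y; decide

theorem zetaInv_add (A B : EndV I) : zetaInv p η (A + B) = zetaInv p η A + zetaInv p η B := by
  ext ⟨a, b⟩
  simp only [Pi.add_apply, zetaInv_apply, LinearMap.add_apply, form_add_left, map_add]

theorem zeta_add (t t' : Mod (I × I)) : zeta p η (t + t') = zeta p η t + zeta p η t' := by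
  refine linearMap_ext_e fun b => ?_
  ext c
  simp only [LinearMap.add_apply, Pi.add_apply, zeta_e, smul_add, Finset.sum_add_distrib]

theorem zeta_smul (s : Gr) (t : Mod (I × I)) :
    zeta p η (s • t) = (s • (1 : EndV I)) * zeta p η t := by
  refine linearMap_ext_e fun b => ?_
  ext c
  change _ = s * (zeta p η t (e b) c)
  simp only [zeta_e, Finset.mul_sum, Pi.smul_apply, smul_eq_mul, mul_smul_comm]

/-- The scalar multiplies coordinates on the left; being even, it commutes with every matrix entry,
so any A is allowed. -/
theorem smul_one_central {s : Gr} (hs : s ∈ Gr.part 0) (A : EndV I) :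
    (s • (1 : EndV I)) * A = A * (s • (1 : EndV I)) := by
  refine LinearMap.ext fun v => ?_
  ext a
  change s * A v a = A (s • v) a
  rw [endV_apply_eq A v, endV_apply_eq A (s • v), Finset.mul_sum]
  refine Finset.sum_congr rfl fun b _ => ?_
  rw [Pi.smul_apply, smul_eq_mul, ← mul_assoc, ← mul_assoc, commute_of_even hs]

end Space

section Space

variable {I : Type*} [Fintype I] [DecidableEq I] {p : I → ZMod 2} {η : Matrix I I ℂ}

/-! ### Uniqueness of the extension -/

/-- `tensProd` as a multilinear map. -/
def tensProdM (p : I → ZMod 2) (d : ℕ) :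
    MultilinearMap ℂ (fun _ : Fin d => Mod (I × I)) (Tens (2 * d) I) :=
  MultilinearMap.pi fun i => (MultilinearMap.mkPiAlgebraFin ℂ d Gr).compLinearMap fun k =>
    (tw (∑ l ∈ Finset.Ioi k, parP p (blocks i l))).toLinearMap.comp (LinearMap.proj (blocks i k))

/-- `t ↦ G (t 0 ⊗ ⋯ ⊗ t (d - 1) ⊗ y)`. -/
def evalTens {d : ℕ} (p : I → ZMod 2) (G : TT (2 * d) I →ₗ[Grᵐᵒᵖ] Gr) (y : Tens (2 * d) I) :
    MultilinearMap ℂ (fun _ : Fin d => Mod (I × I)) Gr :=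
  LinearMap.compMultilinearMap
    { toFun := fun x => G (tmul (parT p) x y)
      map_add' := fun x x' => by
        rw [← map_add]
        congr 1
        ext
        simp [tmul, add_mul]
      map_smul' := fun c x => by
        rw [RingHom.id_apply, ← LinearMap.map_smul_of_tower]
        congr 1
        ext
        simp [tmul] } (tensProdM p d)

theorem evalTens_apply {d : ℕ} (G : TT (2 * d) I →ₗ[Grᵐᵒᵖ] Gr) (y : Tens (2 * d) I)
    (t : Fin d → Mod (I × I)) :
    evalTens p G y t = G (tmul (parT p) (tensProd p t) y) := rfl

/-- C-invariance of `G`, read as symmetry of a multilinear function under permutations and flips of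
its even arguments. -/
theorem evalTens_block {d : ℕ} {G : TT (2 * d) I →ₗ[Grᵐᵒᵖ] Gr}
    (hG : ∀ σ ∈ centr d, ∀ z, G (varpiLeft p σ z) = G z) (y : Tens (2 * d) I)
    (τ : Equiv.Perm (Fin d)) (ε : Fin d → Bool) {t : Fin d → Mod (I × I)}
    (ht : ∀ k, IsHomog (parP p) 0 (t k)) :
    evalTens p G y ((fun k => if ε k then flip p (t k) else t k) ∘ τ.symm) = evalTens p G y t := by
  obtain ⟨σ, hσ, h⟩ := exists_mem_centr τ ε
  rw [evalTens_apply, evalTens_apply, ← hG σ hσ (tmul (parT p) (tensProd p t) y),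
    varpiLeft_tmul, varpi_tensProd p h ht]

theorem flip_isHomog {t : Mod (I × I)} (ht : IsHomog (parP p) 0 t) :
    IsHomog (parP p) 0 (flip p t) := by
  intro ab
  refine Submodule.smul_mem _ _ ?_
  have := ht ab.swap
  simpa [parP, add_comm] using this

theorem flip_flip (t : Mod (I × I)) : flip p (flip p t) = t := by
  ext ab
  simp only [flip, smul_smul, Prod.fst_swap, Prod.snd_swap, Prod.swap_swap]
  rw [mul_comm (p ab.2), sgn_mul_self, one_smul]

theorem flip_add (t t' : Mod (I × I)) : flip p (t + t') = flip p t + flip p t' := by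
  ext ab
  simp [flip]

theorem flip_smul (s : Gr) (t : Mod (I × I)) : flip p (s • t) = s • flip p t := by
  ext ab
  simp [flip]

/-- A `C`-invariant linear map that vanishes on the `ω(A)^{⊗ d} ⊗ y` vanishes on products of
flip-invariant elements with square zero factors. -/
theorem evalTens_eq_zero (hη : IsOrthosymplectic p η) {d : ℕ} {G : TT (2 * d) I →ₗ[Grᵐᵒᵖ] Gr}
    (hG : ∀ σ ∈ centr d, ∀ z, G (varpiLeft p σ z) = G z) (y : Tens (2 * d) I)
    (hA : ∀ A, IsEven p A →
      G (tmul (parT p) (tensPow p d (zetaInv p η (omega p η A))) y) = 0)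
    {s : Fin d → Gr} (hs : ∀ k, s k ∈ Gr.part 0) (hss : ∀ k, s k * s k = 0)
    {t : Fin d → Mod (I × I)} (ht : ∀ k, IsHomog (parP p) 0 (s k • t k))
    (hf : ∀ k, flip p (s k • t k) = s k • t k) :
    evalTens p G y (fun k => s k • t k) = 0 := by
  let T : Fin d → Mod (I × I) := fun k => s k • t k
  -- The base point is the tensor of the identity: the argument is the tensor of 1 + B with B
  -- nilpotent and self-adjoint, and 1 + B = A² = ω(A).
  have h1 : ∀ S : Finset (Fin d),
      evalTens p G y (fun _ => zetaInv p η 1 + ∑ k ∈ S, T k) = 0 := by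
    intro S
    have hT : IsHomog (parP p) 0 (∑ k ∈ S, T k) := by
      intro ab
      rw [Finset.sum_apply]
      exact Submodule.sum_mem _ fun k _ => ht k ab
    have hTf : flip p (∑ k ∈ S, T k) = ∑ k ∈ S, T k := by
      have h : flip p (∑ k ∈ S, T k) = ∑ k ∈ S, flip p (T k) :=
        map_sum (AddMonoidHom.mk' (flip p) flip_add) T S
      rw [h]
      exact Finset.sum_congr rfl fun k _ => hf k
    have hB := zeta_isSelfAdj hη hT hTf
    have hnil : IsNilpotent (zeta p η (∑ k ∈ S, T k)) := by
      have h : zeta p η (∑ k ∈ S, T k) = ∑ k ∈ S, (s k • (1 : EndV I)) * zeta p η (t k) := by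
        simp only [← zeta_smul]
        exact map_sum (AddMonoidHom.mk' (zeta p η) zeta_add) T S
      rw [h]
      refine isNilpotent_sum_central_mul _ _ (fun k => smul_one_central (hs k)) (fun k => ?_) S
      refine LinearMap.ext fun v => ?_
      change s k • s k • v = 0
      rw [smul_smul, hss, zero_smul]
    obtain ⟨P, hP⟩ := exists_aeval_sq_eq hnil
    have hPA := hB.aeval P
    have h := hA _ hPA.1
    rw [hPA.omega_eq hη, hP, zetaInv_add, zetaInv_zeta hη hT, tensPow_eq] at h
    exact h
  -- The left side vanishes by `h1`; by symmetry the right side is ± d! times the wanted value.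
  have h2 := polarisation (evalTens p G y) (zetaInv p η 1) T
  have h3 : ∀ τ : Equiv.Perm (Fin d), evalTens p G y (T ∘ τ) = evalTens p G y T := fun τ =>
    evalTens_block hG y τ.symm (fun _ => false) ht
  simp only [h1, h3, smul_zero, Finset.sum_const_zero, Finset.sum_const, Finset.card_univ,
    Fintype.card_perm, Fintype.card_fin] at h2
  rw [← Nat.cast_smul_eq_nsmul ℂ, smul_smul] at h2
  refine (smul_eq_zero.1 h2.symm).resolve_left ?_
  exact mul_ne_zero (pow_ne_zero _ (by norm_num)) (Nat.cast_ne_zero.2 (Nat.factorial_ne_zero d))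

/-- A nonzero value on a basis vector would survive multiplication by scalars in fresh generators,
while polarisation and symmetrisation force that product to vanish. -/
theorem eq_zero_of_vanish (hη : IsOrthosymplectic p η) {d : ℕ} {G : TT (2 * d) I →ₗ[Grᵐᵒᵖ] Gr}
    (hG : ∀ σ ∈ centr d, ∀ z, G (varpiLeft p σ z) = G z)
    (hA : ∀ A, IsEven p A → ∀ v : Fin (2 * d) → Mod I,
      G (tmul (parT p) (tensPow p d (zetaInv p η (omega p η A))) (tprod p v)) = 0) :
    G = 0 := by
  refine linearMap_ext_e fun im => ?_
  obtain ⟨i, m⟩ := im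
  rw [LinearMap.zero_apply]
  by_contra hne
  -- θ_k has the parity of the `k`-th basis vector, so that the tensors `t k` below are even.
  obtain ⟨s, θ, hs, hθ, hss, hprod⟩ :=
    exists_mul_oprod_ne_zero hne fun k : Fin d => parP p (blocks i k)
  refine hprod ?_
  let t : Fin d → Mod (I × I) := fun k => Pi.single (blocks i k) (θ k)
  have ht : ∀ k, IsHomog (parP p) 0 (s k • t k) := by
    intro k ab
    rw [Pi.smul_apply, smul_eq_mul]
    refine mul_mem_part (hs k) ?_
    by_cases h : ab = blocks i k
    · subst h
      simpa [t] using hθ k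
    · simp [t, h]
  have hsum : ∀ k, s k • (t k + flip p (t k)) = s k • t k + flip p (s k • t k) := fun k => by
    rw [smul_add, flip_smul]
  have h1 := evalTens_eq_zero hη hG (e m) (fun A hA' => by
      have := hA A hA' fun k => e (m k)
      rwa [tprod_e] at this) hs hss (t := fun k => t k + flip p (t k))
    (fun k ab => by
      rw [hsum]
      exact Submodule.add_mem _ (ht k ab) (flip_isHomog (ht k) ab))
    (fun k => by rw [hsum, flip_add, flip_flip, add_comm])
  simp only [hsum] at h1
  -- Expanding the symmetrised product gives 2^d terms, all equal by flip-invariance.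
  have h2 := (evalTens p G (e m)).map_add_univ (fun k => flip p (s k • t k)) fun k => s k • t k
  have h3 : ∀ S : Finset (Fin d), evalTens p G (e m)
      (S.piecewise (fun k => flip p (s k • t k)) fun k => s k • t k)
      = evalTens p G (e m) fun k => s k • t k := by
    intro S
    rw [← evalTens_block hG (e m) 1 (fun k => decide (k ∈ S)) ht]
    congr 1
    ext1 k
    have h : (1 : Equiv.Perm (Fin d)).symm k = k := rfl
    simp [Finset.piecewise, h]
  have h4 : evalTens p G (e m) (fun k => s k • t k) = 0 := by
    have h5 : ((fun k => flip p (s k • t k)) + fun k => s k • t k)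
        = fun k => s k • t k + flip p (s k • t k) := by
      ext1 k
      exact add_comm _ _
    rw [h5, h1] at h2
    simp only [h3, Finset.sum_const] at h2
    rw [← Nat.cast_smul_eq_nsmul ℂ] at h2
    refine (smul_eq_zero.1 h2.symm).resolve_left ?_
    simp
  rw [evalTens_apply] at h4
  -- The unsymmetrised product is a single basis vector times a right scalar, which is ± ∏ s_k θ_k.
  have h5 : tmul (parT p) (tensProd p fun k => s k • t k) (e m) =
      MulOpposite.op (tw (parT p m) (oprod fun k => tw (∑ l ∈ Finset.Ioi k, parP p (blocks i l))
        (s k * θ k))) • (e (i, m) : TT (2 * d) I) := by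
    ext ⟨i', m'⟩
    rw [Pi.smul_apply, tmul, tensProd, tprod_apply]
    by_cases hm : m' = m
    · subst hm
      by_cases hi : i' = i
      · subst hi
        simp [e, t]
      · have hb : blocks i' ≠ blocks i := fun h => hi (blocks.injective h)
        obtain ⟨k, hk⟩ := Function.ne_iff.1 hb
        rw [oprod_eq_zero k (by simp [t, hk])]
        simp [e, hi]
    · simp [e, hm]
  have hmem : ∀ k, s k * θ k ∈ Gr.part (parP p (blocks i k)) := fun k => by
    simpa using mul_mem_part (hs k) (hθ k)
  rw [h5, map_smul, oprod_tw hmem, tw_of_mem _ (Submodule.smul_mem _ _ (oprod_mem hmem))] at h4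
  rw [op_smul_eq_mul, smul_smul, mul_smul_comm] at h4
  refine (smul_eq_zero.1 h4).resolve_left ?_
  rw [← sgn_add]
  intro h
  have := sgn_mul_self (parT p m * ∑ k, parP p (blocks i k)
    + ∑ k, (∑ l ∈ Finset.Ioi k, parP p (blocks i l)) * parP p (blocks i k))
  rw [h, mul_zero] at this
  exact zero_ne_one this

end Space

section Space

variable {I : Type*} [Fintype I] [DecidableEq I] {p : I → ZMod 2} {η : Matrix I I ℂ}

/-! ### The maps on Brauer diagrams -/

theorem kappa_single (hη : IsOrthosymplectic p η) {d : ℕ} {D : Diagram d}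
    {π : Equiv.Perm (Fin (2 * d))} (h : (D0 d).comp π = D) :
    kappa p η d (Finsupp.single D 1) = kappaPerm p η π := by
  rw [kappa, Finsupp.linearCombination_single, one_smul]
  have h1 := comp_eq_comp_iff (D.exists_perm.choose_spec.trans h.symm)
  rw [← kappaPerm_mul hη h1 π, inv_mul_cancel_right]
  rfl

theorem chi_single {d : ℕ} {D : Diagram d} {π : Equiv.Perm (Fin (2 * d))}
    (h : (D0 d).comp π = D) :
    chi d (Finsupp.single D 1) = symmetriser d * MonoidAlgebra.single π 1 := by
  rw [chi, Finsupp.linearCombination_single, one_smul]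
  have h1 := comp_eq_comp_iff (D.exists_perm.choose_spec.trans h.symm)
  rw [← symmetriser_mul_single h1 π, inv_mul_cancel_right]
  rfl

/-- Reindexing the average by left translation with σ matches it term by term with
`deltaPerm_varpiLeft`. -/
theorem delta_chi_varpiLeft {d : ℕ} (b : Brauer d) {σ : Equiv.Perm (Fin (2 * d))}
    (hσ : σ ∈ centr d) (z : TT (2 * d) I) :
    delta p (chi d b) (varpiLeft p σ z) = delta p (chi d b) z := by
  classical
  induction b using Finsupp.induction_linear with
  | zero => simp
  | add b b' hb hb' => simp only [map_add, LinearMap.add_apply, hb, hb']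
  | single D c =>
    rw [← Finsupp.smul_single_one, map_smul, map_smul,
      chi_single D.exists_perm.choose_spec, delta_symmetriser]
    simp only [LinearMap.smul_apply, LinearMap.sum_apply]
    congr 2
    rw [← Equiv.sum_comp (Equiv.mulLeft (⟨σ, hσ⟩ : centr d))
      fun τ => deltaPerm p ((τ : Equiv.Perm (Fin (2 * d))) * _) (varpiLeft p σ z)]
    refine Finset.sum_congr rfl fun τ _ => ?_
    rw [Equiv.coe_mulLeft, Subgroup.coe_mul, mul_assoc]
    exact deltaPerm_varpiLeft _ σ z

theorem deltaPerm_omega (hη : IsOrthosymplectic p η) {A : EndV I} (hA : IsEven p A) {d : ℕ}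
    (π : Equiv.Perm (Fin (2 * d))) (v : Fin (2 * d) → Mod I) :
    deltaPerm p π (tmul (parT p) (tensPow p d (zetaInv p η (omega p η A))) (tprod p v))
      = kappaPerm p η π (tprod p fun k => A (v k)) := by
  rw [deltaPerm_tmul, pairing_tensPow_omega hη hA, ← varpi_tpow p π hA, tpow_tprod p hA]
  rfl

/-- All |C| terms of the average equal the same κ_π, so the factor |C|⁻¹ cancels. -/
theorem delta_chi_omega (hη : IsOrthosymplectic p η) {A : EndV I} (hA : IsEven p A) {d : ℕ}
    (b : Brauer d) (v : Fin (2 * d) → Mod I) :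
    delta p (chi d b) (tmul (parT p) (tensPow p d (zetaInv p η (omega p η A))) (tprod p v))
      = kappa p η d b (tprod p fun k => A (v k)) := by
  classical
  induction b using Finsupp.induction_linear with
  | zero => simp
  | add b b' hb hb' => simp only [map_add, LinearMap.add_apply, hb, hb']
  | single D c =>
    rw [← Finsupp.smul_single_one, map_smul, map_smul, map_smul,
      chi_single D.exists_perm.choose_spec, kappa_single hη D.exists_perm.choose_spec,
      delta_symmetriser]
    simp only [LinearMap.smul_apply, LinearMap.sum_apply, deltaPerm_omega hη hA]
    congr 1
    rw [Finset.sum_congr rfl fun σ _ => by rw [kappaPerm_mul hη σ.2]]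
    rw [Finset.sum_const, Finset.card_univ, ← Nat.card_eq_fintype_card,
      ← Nat.cast_smul_eq_nsmul ℂ, smul_smul, inv_mul_cancel₀, one_smul]
    exact Nat.cast_ne_zero.2 Nat.card_pos.ne'

/-- The linear map on `S^d(S^2(V^*)) ⊗ T^{2d}(V)` induced by `δ(χ(b))`. -/
def extension (p : I → ZMod 2) {d : ℕ} (b : Brauer d) : SymTens p d →ₗ[Grᵐᵒᵖ] Gr :=
  (symKer p d).liftQ (delta p (chi d b)) (by
    rw [symKer, Submodule.span_le]
    rintro _ ⟨σ, hσ, z, rfl⟩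
    rw [SetLike.mem_coe, LinearMap.mem_ker, map_sub, delta_chi_varpiLeft b hσ, sub_self])

theorem extension_comp_mkQ {d : ℕ} (b : Brauer d) :
    (extension p b).comp (symKer p d).mkQ = delta (I := I) p (chi d b) :=
  Submodule.liftQ_mkQ _ _ _

theorem isExtension_extension (hη : IsOrthosymplectic p η) {d : ℕ} (b : Brauer d) :
    IsExtension p η (kappa p η d b) (extension p b) := by
  intro A hA v
  rw [← LinearMap.comp_apply, extension_comp_mkQ, delta_chi_omega hη hA]

theorem IsExtension.unique (hη : IsOrthosymplectic p η) {d : ℕ} {L : Dual (Fin (2 * d) → I)}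
    {F F' : SymTens p d →ₗ[Grᵐᵒᵖ] Gr} (hF : IsExtension p η L F) (hF' : IsExtension p η L F') :
    F = F' := by
  rw [← sub_eq_zero]
  refine Submodule.linearMap_qext _ ?_
  rw [LinearMap.zero_comp]
  refine eq_zero_of_vanish hη (fun σ hσ z => ?_) fun A hA v => ?_
  · rw [LinearMap.comp_apply, LinearMap.comp_apply, ← sub_eq_zero, ← map_sub, ← map_sub]
    have h : (symKer p d).mkQ (varpiLeft p σ z - z) = 0 :=
      (Submodule.Quotient.mk_eq_zero _).2 (Submodule.subset_span ⟨σ, hσ, z, rfl⟩)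
    rw [h, map_zero]
  · rw [LinearMap.comp_apply, LinearMap.sub_apply, hF A hA v, hF' A hA v, sub_self]

theorem kappa_mem_invOSp (hη : IsOrthosymplectic p η) {d : ℕ} (b : Brauer d) :
    kappa p η d b ∈ invOSp p η (2 * d) := by
  rw [kappa, Finsupp.linearCombination_apply]
  exact Submodule.sum_mem _ fun D _ => Submodule.smul_mem _ _ (kappaPerm_mem_invOSp hη _)

theorem delta_mem_invGL {r : ℕ} (x : MonoidAlgebra Gr (Equiv.Perm (Fin r))) :
    delta (I := I) p x ∈ invGL p r :=
  Submodule.sum_mem _ fun π _ => Submodule.smul_mem _ _ (deltaPerm_mem_invGL π)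

/-- `h` uses an arbitrarily chosen extension; uniqueness identifies it with the one induced by
δ(χ(b)). -/
theorem h_eq (hη : IsOrthosymplectic p η) {d : ℕ} (b : Brauer d) :
    h p η (kappa p η d b) = delta p (chi d b) := by
  have hL : ∃ F, IsExtension p η (kappa p η d b) F := ⟨_, isExtension_extension hη b⟩
  rw [h, dif_pos hL, hL.choose_spec.unique hη (isExtension_extension hη b), extension_comp_mkQ]

end Space
end
end OrthoSuper

theorem mainTheorem5 {I : Type*} [Fintype I] [DecidableEq I] (p : I → ZMod 2)
    (η : Matrix I I ℂ) (hη : OrthoSuper.IsOrthosymplectic p η) (d : ℕ) :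
    (∀ (D : OrthoSuper.Diagram d) (π : Equiv.Perm (Fin (2 * d))),
      (OrthoSuper.D0 d).comp π = D →
        OrthoSuper.kappa p η d (Finsupp.single D 1) = OrthoSuper.kappaPerm p η π ∧
        OrthoSuper.chi d (Finsupp.single D 1)
          = OrthoSuper.symmetriser d * MonoidAlgebra.single π 1) ∧
    ∀ b : OrthoSuper.Brauer d,
      OrthoSuper.kappa p η d b ∈ OrthoSuper.invOSp p η (2 * d) ∧
      (∃! F, OrthoSuper.IsExtension p η (OrthoSuper.kappa p η d b) F) ∧
      OrthoSuper.delta p (OrthoSuper.chi d b) ∈ OrthoSuper.invGL p (2 * d) ∧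
      OrthoSuper.h p η (OrthoSuper.kappa p η d b)
        = OrthoSuper.delta p (OrthoSuper.chi d b) :=
  ⟨fun _ _ hD => ⟨OrthoSuper.kappa_single hη hD, OrthoSuper.chi_single hD⟩, fun b =>
    ⟨OrthoSuper.kappa_mem_invOSp hη b,
      ⟨_, OrthoSuper.isExtension_extension hη b,
        fun _ hF => hF.unique hη (OrthoSuper.isExtension_extension hη b)⟩,
      OrthoSuper.delta_mem_invGL _, OrthoSuper.h_eq hη b⟩⟩
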